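/- Let $F_2$ be the free group with basis $\{a,b\}$, and for $w\in F_2$ let $\|w\|$ be its cyclic length, i.e. the length of a cyclically reduced word conjugate to $w$. Let $\sigma,\tau$ be the automorphisms of $F_2$ given by $\sigma(a)=ab$, $\sigma(b)=b$ and $\tau(a)=a$, $\tau(b)=ba$. A chain of type (C1) is an automorphism $\tau^{m_r}\sigma^{l_r}\cdots\tau^{m_1}\sigma^{l_1}$, and a chain of type (C2) is an automorphism $\tau^{-m_r}\sigma^{-l_r}\cdots\tau^{-m_1}\sigma^{-l_1}$, with all $m_i,l_i\ge 0$; its length is $\sum_{i=1}^r(m_i+l_i)$. For automorphisms $\beta,\psi$ of $F_2$ and $w\in F_2$ put $$\|\beta:\psi:w\|:=\max\{1,\ \|\beta\psi(w)\|-\|\psi(w)\|\}.$$ Let $u,v\in F_2$ with $v\neq 1$ and $\|u\|\ge\|v\|$, and put $k=\|u\|+1$. Let $\Omega_1$ (respectively $\Omega_2$) be the set of all chains of type (C1) (respectively (C2)) of length at most $2\|u\|+5$, and let $\Omega=\Omega_1\cup\Omega_2$. Suppose that for each $\alpha\in\{\sigma,\tau\}$ $$\|\alpha^{k+1}\psi_1(u)\|=\|\alpha^{k}\psi_1(u)\|\iff\|\alpha^{k+1}\psi_1(v)\|=\|\alpha^{k}\psi_1(v)\|\qquad\text{for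 every }\psi_1\in\Omega_1,$$ $$\|\alpha^{-k-1}\psi_2(u)\|=\|\alpha^{-k}\psi_2(u)\|\iff\|\alpha^{-k-1}\psi_2(v)\|=\|\alpha^{-k}\psi_2(v)\|\qquad\text{for every }\psi_2\in\Omega_2.$$ Then $u$ and $v$ are boundedly translation equivalent in $F_2$: there is $C>0$ such that $\frac1C\le\frac{\|\phi(u)\|}{\|\phi(v)\|}\le C$ for every automorphism $\phi$ of $F_2$. More specifically, let $$\Delta:=\left\{\frac{\|\psi(u)\|}{\|\psi(v)\|},\ \frac{\|\alpha:\psi_1:u\|}{\|\alpha:\psi_1:v\|},\ \frac{\|\alpha^{-1}:\psi_2:u\|}{\|\alpha^{-1}:\psi_2:v\|}\ \middle|\ \psi\in\Omega,\ \psi_1\in\Omega_1,\ \psi_2\in\Omega_2,\ \alpha\in\{\sigma,\tau\}\right\}.$$ Then $\Delta$ is a finite set of positive real numbers, and $$\min\Delta\le\frac{\|\phi(u)\|}{\|\phi(v)\|}\le\max\Delta\qquad\text{for every automorphism }\phi\text{ of }F_2.$$ -/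

import Mathlib

/-- The free group of rank two, with basis `a = of 0`, `b = of 1`. -/
abbrev F2 : Type := FreeGroup (Fin 2)

namespace F2

/-- The basis element `a`. -/
def a : F2 := FreeGroup.of 0

/-- The basis element `b`. -/
def b : F2 := FreeGroup.of 1

/-- The cyclic length `‖w‖`: the length of a cyclically reduced word conjugate to `w`. -/
def cycLen (w : F2) : ℕ := (FreeGroup.reduceCyclically w.toWord).length

/-- The Whitehead automorphism `σ = ({a}, b)`, that is, `a ↦ ab`, `b ↦ b`. -/
def sigma : MulAut F2 :=
  MonoidHom.toMulEquiv (FreeGroup.lift ![a * b, b]) (FreeGroup.lift ![a * b⁻¹, b])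
    (by ext i; fin_cases i <;> simp [a, b]) (by ext i; fin_cases i <;> simp [a, b])

/-- The Whitehead automorphism `τ = ({b}, a)`, that is, `a ↦ a`, `b ↦ ba`. -/
def tau : MulAut F2 :=
  MonoidHom.toMulEquiv (FreeGroup.lift ![a, b * a]) (FreeGroup.lift ![a, b * a⁻¹])
    (by ext i; fin_cases i <;> simp [a, b]) (by ext i; fin_cases i <;> simp [a, b])

theorem sigma_a : sigma a = a * b := by simp [sigma, a]

theorem sigma_b : sigma b = b := by simp [sigma, b]

theorem tau_a : tau a = a := by simp [tau, a]

theorem tau_b : tau b = b * a := by simp [tau, b]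

/-- For the exponent list `[(m_k, l_k), …, (m_1, l_1)]`, the chain
`τ ^ m_k σ ^ l_k ⋯ τ ^ m_1 σ ^ l_1` of type (C1). -/
def chainC1 (L : List (ℕ × ℕ)) : MulAut F2 := (L.map fun p => tau ^ p.1 * sigma ^ p.2).prod

/-- For the exponent list `[(m_k, l_k), …, (m_1, l_1)]`, the chain
`τ ^ (-m_k) σ ^ (-l_k) ⋯ τ ^ (-m_1) σ ^ (-l_1)` of type (C2). -/
def chainC2 (L : List (ℕ × ℕ)) : MulAut F2 :=
  (L.map fun p => tau⁻¹ ^ p.1 * sigma⁻¹ ^ p.2).prod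

/-- The length `∑ (m_i + l_i)` of a chain with the given exponent list. -/
def chainLen (L : List (ℕ × ℕ)) : ℕ := (L.map fun p => p.1 + p.2).sum

/-- The set of all chains of type (C1) of length at most `N`. -/
def Omega1 (N : ℕ) : Set (MulAut F2) := {ψ | ∃ L, chainLen L ≤ N ∧ chainC1 L = ψ}

/-- The set of all chains of type (C2) of length at most `N`. -/
def Omega2 (N : ℕ) : Set (MulAut F2) := {ψ | ∃ L, chainLen L ≤ N ∧ chainC2 L = ψ}

/-- `‖β : ψ : w‖ = max {1, ‖β ψ(w)‖ - ‖ψ(w)‖}`, with the difference taken in `ℤ`. -/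
def incr (β ψ : MulAut F2) (w : F2) : ℤ :=
  max 1 ((cycLen (β (ψ w)) : ℤ) - (cycLen (ψ w) : ℤ))

/-- Bounded translation equivalence in `F2`. -/
def BoundedlyTranslationEquivalent (u v : F2) : Prop :=
  ∃ C : ℝ, 0 < C ∧ ∀ φ : MulAut F2,
    1 / C ≤ (cycLen (φ u) : ℝ) / (cycLen (φ v) : ℝ) ∧
      (cycLen (φ u) : ℝ) / (cycLen (φ v) : ℝ) ≤ C

/-- The set `Δ` of ratios attached to `u` and `v`, with chains of length at most `N`. -/
def Delta (N : ℕ) (u v : F2) : Set ℝ :=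
  {x | ∃ ψ ∈ Omega1 N ∪ Omega2 N, x = (cycLen (ψ u) : ℝ) / (cycLen (ψ v) : ℝ)} ∪
  {x | ∃ ψ ∈ Omega1 N, ∃ α : MulAut F2, (α = sigma ∨ α = tau) ∧
    x = (incr α ψ u : ℝ) / (incr α ψ v : ℝ)} ∪
  {x | ∃ ψ ∈ Omega2 N, ∃ α : MulAut F2, (α = sigma ∨ α = tau) ∧
    x = (incr α⁻¹ ψ u : ℝ) / (incr α⁻¹ ψ v : ℝ)}

end F2

/-!
Modulo inner automorphisms and signed permutations of the basis, none of which changes `cycLen`,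
every automorphism of `F2` is a chain of type (C1) or (C2) (`exists_chain`). Nielsen reduction
(`aut_induction`) shows that `σ`, `τ` and their inverses generate; the product
`ρ = τ σ⁻¹ τ` is a signed permutation up to conjugation and interchanges the two kinds of chains
by conjugation, which lets any product of generators be rewritten with signs of one kind only.
The automorphism `a ↦ a`, `b ↦ b⁻¹` turns chains of type (C2) into chains of type (C1), so that
only positive chains need to be studied.

Under `σ` a cyclic word loses two letters for each peak, that is, for each subword `a b⁻¹` or
`b a⁻¹`, and gains one for each letter `a^±`. As long as the number of peaks is constant, lengths
and increments therefore grow linearly, with coefficients that do not depend on the word. The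
peaks that can disappear belong to the subwords `a b^(-m) a`, `b a^(-m) b` with `m ≥ 1` and their
inverses, which are called opposed runs. Their development under `σ` and `τ` is controlled by
finitely many inequalities between numbers of subwords (`IsStep`), each of which is a statement
about closed walks in a finite automaton and is proved by exhibiting a potential function on the
states (`Dominates`). In particular a quantity that bounds the total length of the opposed runs
decreases with every step `σ` while there are opposed runs of `b`, and likewise for `τ` and `a`.
Hence, for a word of cyclic length at most `K`, the opposed runs of one of the two generators have
disappeared after any `K` steps, and after at most `K` further steps the word is `Linear`: the
current power of `σ` or `τ` acts linearly, and after the next change of generator everything is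
linear (`linear_after_long_block`, `linear_after_turn`).

From a moment where both `u` and `v` are linear, the pair of lengths is a sum of pairs
`(cycLen (ψ u), cycLen (ψ v))` and of pairs of increments at short chains `ψ`. The hypothesis
says that the two increments in such a pair vanish simultaneously, so each pair `(x, y)` satisfies
`min Δ * y ≤ x ≤ max Δ * y`, and so does their sum (`inCone_evolve`).
-/

namespace F2

/-! ### The automaton reading a word -/

/-- A letter of a word in `F2`: a generator and a sign, `true` for the generator itself. -/
abbrev Letter : Type := Fin 2 × Bool

/-- The state of an automaton that reads a word. It consists of the last letter read and a flag on
the run (maximal power of one letter) to which that letter belongs: the flag is `1` or `2` if the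
run was preceded by a letter of the other generator with the opposite sign, `1` if the run so far
has length one and `2` if it is longer; otherwise the flag is `0`. -/
abbrev RunState : Type := Letter × Fin 3

/-- The state reached from `s` by reading `y`. -/
def next (s : RunState) (y : Letter) : RunState :=
  (y, if s.1 = y then ![0, 2, 2] s.2 else if s.1.1 ≠ y.1 ∧ s.1.2 ≠ y.2 then 1 else 0)

/-- The state reached from `s` by reading the word `L`. -/
def run (s : RunState) (L : List Letter) : RunState := L.foldl next s

/-- The sum of the weights `w` along the walk that starts at `s` and reads the word. -/
def total (w : RunState → Letter → ℤ) : RunState → List Letter → ℤ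
  | _, [] => 0
  | s, y :: L => w s y + total w (next s y) L

/-- What the transducer for the automorphism `x ↦ x * of i` (`x` the other generator, `of i` fixed)
emits on reading the letter `x`. The image of a positive letter ends in `of i`, which the next
letter may cancel; so after a positive letter (`pos = true`) one letter `of i` is pending. -/
def subst (i : Fin 2) (pos : Bool) (x : Letter) : List Letter :=
  if pos then
    if x.1 = i then (if x.2 then [(i, true)] else [])
    else (if x.2 then [(i, true), x] else [x])
  else
    if x.1 = i then (if x.2 then [] else [(i, false)])
    else (if x.2 then [x] else [(i, false), x])

/-- The output of the transducer `subst i` on a word. -/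
def substWord (i : Fin 2) : RunState → List Letter → List Letter
  | _, [] => []
  | s, x :: L => subst i s.1.2 x ++ substWord i (next s x) L

/-- An invariant that couples the state `s` of the automaton reading the input of `subst i` with the
state `t` of the automaton reading its output. -/
def Compat (i : Fin 2) (s t : RunState) : Prop :=
  if s.1.1 = i then
    (s.2 = 0 → t = s) ∧ (s.2 = 1 → t.1 = (i.rev, !s.1.2)) ∧ (s.2 = 2 → t.1 = s.1 ∧ t.2 ≠ 0)
  else t.1 = s.1 ∧ (s.2 ≠ 1 → t.2 = 0)

instance (i : Fin 2) (s t : RunState) : Decidable (Compat i s t) := by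
  unfold Compat; infer_instance

@[simp] theorem run_append (s : RunState) (L L' : List Letter) :
    run s (L ++ L') = run (run s L) L' := List.foldl_append

theorem total_append (w : RunState → Letter → ℤ) (s : RunState) (L L' : List Letter) :
    total w s (L ++ L') = total w s L + total w (run s L) L' := by
  induction L generalizing s with
  | nil => simp [total, run]
  | cons x L ih => simp [total, ih, run, add_assoc]

/-- Reading `x` in the state `s` creates no cancellation. -/
abbrev Admissible (s : RunState) (x : Letter) : Prop := s.1.1 = x.1 → s.1.2 = x.2

/-- The word `L`, read from the state `s`, is reduced, also at its beginning. -/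
abbrev ReducedFrom (s : RunState) (L : List Letter) : Prop :=
  List.IsChain (fun x y : Letter => x.1 = y.1 → x.2 = y.2) (s.1 :: L)

theorem compat_next : ∀ (i : Fin 2) (s t : RunState) (x : Letter), Compat i s t → Admissible s x →
    ReducedFrom t (subst i s.1.2 x) ∧ Compat i (next s x) (run t (subst i s.1.2 x)) := by
  decide +kernel

/-! ### Subword counts as weights -/

/-- Counts the letters of the generator `i`. -/
def cnt (i : Fin 2) (_ : RunState) (x : Letter) : ℤ := if x.1 = i then 1 else 0

/-- Counts the subwords `a b⁻¹` and `b a⁻¹`, where positive automorphisms cause cancellation. -/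
def peak (s : RunState) (x : Letter) : ℤ :=
  if s.1.1 ≠ x.1 ∧ s.1.2 = true ∧ x.2 = false then 1 else 0

/-- Counts the opposed runs of the generator `i`: with `x` the other generator, these are the
subwords `x i^(-m) x` and `x⁻¹ i^m x⁻¹`, where `m ≥ 1`. -/
def opp (i : Fin 2) (s : RunState) (x : Letter) : ℤ :=
  if s.1.1 = i ∧ x.1 ≠ i ∧ s.1.2 ≠ x.2 ∧ s.2 ≠ 0 then 1 else 0

/-- Counts the opposed runs of the generator `i` that have length one. -/
def opp1 (i : Fin 2) (s : RunState) (x : Letter) : ℤ :=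
  if s.1.1 = i ∧ x.1 ≠ i ∧ s.1.2 ≠ x.2 ∧ s.2 = 1 then 1 else 0

/-- Counts the letters of the runs that are preceded by the other generator with the opposite sign.
This includes all letters of opposed runs. -/
def flagged (s : RunState) (x : Letter) : ℤ := if (next s x).2 ≠ 0 then 1 else 0

/-- The potential `h` shows that the output of `subst i` along any closed walk has total
`w'`-weight at most the total `w`-weight of its input. -/
def Dominates (i : Fin 2) (w w' : RunState → Letter → ℤ) (h : RunState → RunState → ℤ) : Prop :=
  ∀ (s t : RunState) (x : Letter), Compat i s t → Admissible s x →
    total w' t (subst i s.1.2 x) + h (next s x) (run t (subst i s.1.2 x)) ≤ w s x + h s t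

theorem dominates_cnt_rev : ∀ i : Fin 2, Dominates i (cnt i.rev) (cnt i.rev) (fun _ _ => 0) := by
  unfold Dominates; decide +kernel

theorem dominates_neg_cnt_rev : ∀ i : Fin 2,
    Dominates i (-cnt i.rev) (-cnt i.rev) (fun _ _ => 0) := by
  unfold Dominates; decide +kernel

/-- The potential is the number of pending letters. -/
def potCnt (s _t : RunState) : ℤ := if s.1.2 then 1 else 0

/-- Each letter of the other generator creates a letter `of i`, and each peak cancels two. -/
theorem dominates_cnt : ∀ i : Fin 2,
    Dominates i (fun s x => cnt i s x + cnt i.rev s x - 2 * peak s x) (cnt i) potCnt := by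
  unfold Dominates; decide +kernel

theorem dominates_neg_cnt : ∀ i : Fin 2,
    Dominates i (fun s x => -(cnt i s x + cnt i.rev s x - 2 * peak s x)) (-cnt i) (-potCnt) := by
  unfold Dominates; decide +kernel

/-- The potential records that a run `x i⁻¹` has just begun. Its peak does not appear in the output
before the run is known not to be an opposed run of length one. -/
def potPeak (i : Fin 2) (s _t : RunState) : ℤ := if s = ((i, false), 1) then 1 else 0

/-- A peak disappears exactly at an opposed run of length one. -/
theorem dominates_peak : ∀ i : Fin 2,
    Dominates i (fun s x => peak s x - opp1 i s x) peak (potPeak i) := by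
  unfold Dominates; decide +kernel

theorem dominates_neg_peak : ∀ i : Fin 2,
    Dominates i (fun s x => -(peak s x - opp1 i s x)) (-peak) (-potPeak i) := by
  unfold Dominates; decide +kernel

/-- Each opposed run of the generator `i` is shortened by one letter, and vanishes if it had only
one. -/
theorem dominates_opp : ∀ i : Fin 2, Dominates i (fun s x => opp i s x - opp1 i s x) (opp i)
    (fun _ _ => 0) := by
  unfold Dominates; decide +kernel

/-- The potential records that the last opposed run read in the input has turned into a part of a
flagged run of the output that is still open. -/
def potOppRev (i : Fin 2) (s t : RunState) : ℤ :=
  if s.2 = 1 ∧ (t.2 = 2 ∨ s.1.1 = i ∧ t.2 = 1) then 1 else 0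

theorem dominates_opp_rev : ∀ i : Fin 2, Dominates i (opp i.rev) (opp i.rev) (potOppRev i) := by
  unfold Dominates; decide +kernel

theorem dominates_opp1_rev : ∀ i : Fin 2, Dominates i (opp1 i.rev) (opp1 i.rev) (potOppRev i) := by
  unfold Dominates; decide +kernel

/-- The potential is `0` if the current run of the input has more flagged letters than the part of the
output emitted while reading it, and `-1` otherwise. -/
def potFlagged (i : Fin 2) (s t : RunState) : ℤ :=
  if s.2 = 0 ∨ s.1.1 ≠ i ∧ s.2 = 1 ∧ t.2 ≠ 0 then -1 else 0

theorem dominates_flagged : ∀ i : Fin 2,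
    Dominates i (fun s x => flagged s x - opp i s x) flagged (potFlagged i) := by
  unfold Dominates; decide +kernel

/-- The potential for the converse of `dominates_opp1_rev`, up to twice the opposed runs. -/
def potNegOppOne (i : Fin 2) (s t : RunState) : ℤ :=
  if s.2 = 1 then (if s.1.1 ≠ i ∧ t.2 ≠ 1 then 1 else if s.1.1 = i ∧ t.2 = 1 then -1 else 0) else 0

theorem dominates_neg_opp1_rev : ∀ i : Fin 2,
    Dominates i (fun s x => 2 * opp i s x - opp1 i.rev s x) (-opp1 i.rev) (potNegOppOne i) := by
  unfold Dominates; decide +kernel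

/-- The potential for the bound on opposed runs of length at least two in the output. -/
def potOppSub (i : Fin 2) (s t : RunState) : ℤ :=
  if s.2 = 1 ∧ (t.2 = 2 ∨ s.1.1 ≠ i ∧ t.2 = 0) then 1 else 0

/-- An opposed run of the other generator of length at least two arises only by merging, hence from
an opposed run of the generator `i`. -/
theorem dominates_opp_sub_opp1_rev : ∀ i : Fin 2, Dominates i (opp i)
    (fun s x => opp i.rev s x - opp1 i.rev s x) (potOppSub i) := by
  unfold Dominates; decide +kernel

/-! ### Closed walks as cyclic words -/

theorem run_fst (s : RunState) (L : List Letter) : (run s L).1 = L.getLast?.getD s.1 := by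
  induction L generalizing s with
  | nil => rfl
  | cons x L ih =>
    rw [show run s (x :: L) = run (next s x) L from rfl, ih]
    cases L <;> simp [next, List.getLast?_cons]

/-- Reading a word that is not a power of one letter synchronizes the automaton: a run that begins
inside the word determines its own flag. -/
theorem run_const_or_replicate (L : List Letter) :
    (∀ s t, run s L = run t L) ∨ ∃ n x, L = List.replicate n x := by
  induction L using List.reverseRecOn with
  | nil => exact Or.inr ⟨0, (0, true), rfl⟩
  | append_singleton L y ih =>
    rcases ih with h | ⟨n, x, rfl⟩
    · left; intro s t; simp [h s t]
    · rcases n with _ | n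
      · exact Or.inr ⟨1, y, rfl⟩
      · by_cases hxy : x = y
        · subst hxy
          exact Or.inr ⟨n + 2, x, by rw [← List.replicate_succ']⟩
        · left
          have h (s) : (run s (List.replicate (n + 1) x)).1 = x := by
            simp [run_fst, List.getLast?_replicate]
          intro s t
          rw [run_append, run_append]
          change next _ y = next _ y
          simp [next, h, hxy]

theorem next_next_next : ∀ (x : Letter) (s : RunState),
    next (next (next s x) x) x = next (next s x) x := by
  decide +kernel

/-- Every word closes up after it has been read twice, from any initial state. -/
theorem run_run_run (s : RunState) (L : List Letter) :
    run (run (run s L) L) L = run (run s L) L := by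
  rcases run_const_or_replicate L with h | ⟨n, x, rfl⟩
  · exact h _ _
  · have fix (t : RunState) (ht : next t x = t) (m : ℕ) : run t (List.replicate m x) = t := by
      induction m with
      | zero => rfl
      | succ m ih => rw [List.replicate_succ]; change run (next t x) _ = t; rw [ht, ih]
    have two := next_next_next x
    have idem (t : RunState) (ht : next (next t x) x = next t x) (m : ℕ) :
        run t (List.replicate (m + 1) x) = next t x := by
      rw [List.replicate_succ]; exact fix _ ht m
    rcases n with _ | n
    · rfl
    · have h1 : run s (List.replicate (n + 1) x) = next s x ∨
          run s (List.replicate (n + 1) x) = next (next s x) x := by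
        rcases n with _ | n
        · exact Or.inl rfl
        · rw [List.replicate_succ]; right; exact idem _ (two s) n
      have h2 : next (next (run s (List.replicate (n + 1) x)) x) x =
          next (run s (List.replicate (n + 1) x)) x := by
        rcases h1 with h | h <;> rw [h]
        · exact two s
        · rw [two s, two s]
      rw [idem _ h2]
      exact fix _ h2 _

/-- A cyclically reduced word together with a state that makes reading it a closed walk in the
automaton. It represents a conjugacy class of `F2`. -/
structure CyclicRun where
  start : RunState
  word : List Letter
  closed : run start word = start
  reduced : ReducedFrom start word

/-- The total weight of the closed walk. For a weight that recognizes subwords, this is the number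
of their cyclic occurrences. -/
def CyclicRun.count (w : RunState → Letter → ℤ) (r : CyclicRun) : ℤ := total w r.start r.word

/-- The automorphism that fixes `of i` and multiplies the other generator by `of i` on the right. -/
def elem : Fin 2 → MulAut F2 := ![tau, sigma]

theorem elem_of_self (i : Fin 2) : elem i (FreeGroup.of i) = FreeGroup.of i := by
  fin_cases i
  · exact tau_a
  · exact sigma_b

theorem elem_of_rev (i : Fin 2) :
    elem i (FreeGroup.of i.rev) = FreeGroup.of i.rev * FreeGroup.of i := by
  fin_cases i
  · exact tau_b
  · exact sigma_a

/-- The letter that is pending in the transducer `subst i` after a letter of the given sign. -/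
def pending (i : Fin 2) (pos : Bool) : F2 := if pos then FreeGroup.of i else 1

theorem mk_subst (i : Fin 2) (pos : Bool) (x : Letter) :
    FreeGroup.mk (subst i pos x) * pending i x.2 = pending i pos * elem i (FreeGroup.mk [x]) := by
  have hof (j : Fin 2) : FreeGroup.mk [(j, true)] = FreeGroup.of j := rfl
  have hinv (j : Fin 2) : FreeGroup.mk [(j, false)] = (FreeGroup.of j)⁻¹ := rfl
  have hcons (y : Letter) (L) : FreeGroup.mk (y :: L) = FreeGroup.mk [y] * FreeGroup.mk L := by
    simp [FreeGroup.mul_mk]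
  have hnil : FreeGroup.mk ([] : List Letter) = 1 := rfl
  obtain ⟨j, p⟩ := x
  by_cases hj : j = i
  · subst hj
    cases p <;> cases pos <;> simp [subst, pending, hof, hinv, elem_of_self, hnil]
  · obtain rfl : j = i.rev := by revert i j; decide
    have hne := hj
    cases p <;> cases pos <;>
      simp [subst, pending, hne, hof, hinv, elem_of_rev, hcons _ [_], mul_assoc]

/-- The transducer computes `elem i`, up to the pending letters. -/
theorem mk_substWord (i : Fin 2) (s : RunState) (L : List Letter) :
    FreeGroup.mk (substWord i s L) * pending i (run s L).1.2 =
      pending i s.1.2 * elem i (FreeGroup.mk L) := by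
  induction L generalizing s with
  | nil =>
    change 1 * pending i s.1.2 = pending i s.1.2 * elem i 1
    simp
  | cons x L ih =>
    have h1 : FreeGroup.mk (x :: L) = FreeGroup.mk [x] * FreeGroup.mk L := by
      simp [FreeGroup.mul_mk]
    have h2 : run s (x :: L) = run (next s x) L := rfl
    rw [substWord, ← FreeGroup.mul_mk, mul_assoc, h2, ih, h1, map_mul, ← mul_assoc, ← mul_assoc,
      ← mk_subst]
    rfl

theorem compat_run {i : Fin 2} {s t : RunState} {L : List Letter} (h : Compat i s t)
    (hL : ReducedFrom s L) :
    ReducedFrom t (substWord i s L) ∧ Compat i (run s L) (run t (substWord i s L)) := by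
  induction L generalizing s t with
  | nil => exact ⟨by simp [substWord], h⟩
  | cons x L ih =>
    rw [ReducedFrom, List.isChain_cons_cons] at hL
    obtain ⟨h1, h2⟩ := compat_next i s t x h hL.1
    obtain ⟨h3, h4⟩ := ih h2 hL.2
    refine ⟨?_, ?_⟩
    · have key (t : RunState) (A B : List Letter) (hA : ReducedFrom t A)
          (hB : ReducedFrom (run t A) B) : ReducedFrom t (A ++ B) := by
        induction A generalizing t with
        | nil => exact hB
        | cons y A ih =>
          rw [ReducedFrom, List.isChain_cons_cons] at hA
          rw [ReducedFrom, List.cons_append, List.isChain_cons_cons]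
          exact ⟨hA.1, ih (next t y) hA.2 hB⟩
      exact key _ _ _ h1 h3
    · rw [substWord, run_append]; exact h4

/-- The potentials telescope along a walk. -/
theorem Dominates.total_le {i : Fin 2} {w w' : RunState → Letter → ℤ}
    {h : RunState → RunState → ℤ} (H : Dominates i w w' h) {s t : RunState} {L : List Letter}
    (hc : Compat i s t) (hL : ReducedFrom s L) :
    total w' t (substWord i s L) + h (run s L) (run t (substWord i s L)) ≤ total w s L + h s t := by
  induction L generalizing s t with
  | nil => simp [substWord, total, run]
  | cons x L ih =>
    rw [ReducedFrom, List.isChain_cons_cons] at hL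
    have h1 := H s t x hc hL.1
    have h2 := ih (compat_next i s t x hc hL.1).2 hL.2
    rw [substWord, total_append, run_append, total]
    change _ + h (run (next s x) L) _ ≤ _
    linarith

theorem exists_compat : ∀ (i : Fin 2) (s : RunState), ∃ t, Compat i s t := by decide +kernel

/-- The image of a cyclic word under `elem i`, with all inequalities provided by potentials. -/
theorem exists_step (i : Fin 2) (r : CyclicRun) : ∃ r' : CyclicRun,
    (∃ g : F2, FreeGroup.mk r'.word = g * elem i (FreeGroup.mk r.word) * g⁻¹) ∧
    ∀ w w' h, Dominates i w w' h → r'.count w' ≤ r.count w := by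
  obtain ⟨t, ht⟩ := exists_compat i r.start
  -- The output is read twice to reach a state at which it closes up; the invariant is kept.
  set L := substWord i r.start r.word with hL
  have h1 := (compat_run ht r.reduced).2
  rw [r.closed, ← hL] at h1
  have h2 := (compat_run h1 r.reduced).2
  rw [r.closed, ← hL] at h2
  refine ⟨⟨run (run t L) L, L, run_run_run t L, (compat_run h2 r.reduced).1⟩,
    ⟨pending i r.start.1.2, ?_⟩, fun w w' h H => ?_⟩
  · have := mk_substWord i r.start r.word
    rw [r.closed] at this
    exact eq_mul_inv_of_mul_eq this
  · have := H.total_le h2 r.reduced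
    rw [r.closed, ← hL, run_run_run] at this
    exact (add_le_add_iff_right _).1 this

/-! ### Cyclic length -/

open FreeGroup in
theorem cycLen_mk_of_isCyclicallyReduced {L : List Letter} (h : IsCyclicallyReduced L) :
    cycLen (mk L) = L.length := by
  have h1 : (mk L).toWord = L := by rw [toWord_mk]; exact h.isReduced.reduce_eq
  rw [cycLen, h1]
  congr 1
  induction L using List.bidirectionalRec with
  | nil => simp
  | singleton x => simp
  | cons_append x L y =>
    rw [reduceCyclically.cons_append, if_neg]
    · simp
    · rintro ⟨h2, h3⟩
      rw [← List.cons_append, isCyclicallyReduced_cons_append_iff] at h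
      have := h.2 h2
      rw [this] at h3
      cases hx : x.2 <;> simp [hx] at h3

open FreeGroup in
/-- The cyclic length is the growth rate of the lengths of the powers. -/
theorem exists_norm_pow (w : F2) :
    ∃ c : ℕ, ∀ n : ℕ, (w ^ (n + 1)).norm = c + (n + 1) * cycLen w := by
  refine ⟨2 * (reduceCyclically.conjugator w.toWord).length, fun n => ?_⟩
  rw [FreeGroup.norm, toWord_pow, reduceCyclically.reduce_flatten_replicate_succ isReduced_toWord]
  simp [cycLen]
  ring

theorem cycLen_conj_le (g w : F2) : cycLen (g * w * g⁻¹) ≤ cycLen w := by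
  obtain ⟨c, hc⟩ := exists_norm_pow w
  obtain ⟨d, hd⟩ := exists_norm_pow (g * w * g⁻¹)
  by_contra! hlt
  have key (n : ℕ) :
      d + (n + 1) * cycLen (g * w * g⁻¹) ≤ 2 * g.norm + (c + (n + 1) * cycLen w) := by
    rw [← hc, ← hd, conj_pow]
    have h1 := FreeGroup.norm_mul_le (g * w ^ (n + 1)) g⁻¹
    have h2 := FreeGroup.norm_mul_le g (w ^ (n + 1))
    rw [FreeGroup.norm_inv_eq] at h1
    omega
  have := key (2 * g.norm + c)
  nlinarith

theorem cycLen_conj (g w : F2) : cycLen (g * w * g⁻¹) = cycLen w := by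
  refine le_antisymm (cycLen_conj_le g w) ?_
  simpa [mul_assoc] using cycLen_conj_le g⁻¹ (g * w * g⁻¹)

theorem cycLen_pos {w : F2} (hw : w ≠ 1) : 0 < cycLen w := by
  rw [Nat.pos_iff_ne_zero]
  intro h
  obtain ⟨c, hc⟩ := exists_norm_pow w
  have h1 := hc 0
  have h2 := hc 1
  rw [h] at h1 h2
  have hlen := FreeGroup.reduceCyclically.conj_conjugator_reduceCyclically w.toWord
  rw [List.length_eq_zero_iff.1 h] at hlen
  apply hw
  rw [← FreeGroup.mk_toWord (x := w), ← hlen, List.append_nil, ← FreeGroup.mul_mk,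
    ← FreeGroup.inv_mk, mul_inv_cancel]

/-- Every conjugacy class is represented by a cyclic run. -/
theorem exists_cyclicRun (w : F2) :
    ∃ (r : CyclicRun) (g : F2), w = g * FreeGroup.mk r.word * g⁻¹ := by
  set L := FreeGroup.reduceCyclically w.toWord
  have hL : FreeGroup.IsCyclicallyReduced L :=
    FreeGroup.reduceCyclically.isCyclicallyReduced FreeGroup.isReduced_toWord
  have hw := FreeGroup.reduceCyclically.conj_conjugator_reduceCyclically w.toWord
  let s : RunState := ((0, true), 0)
  refine ⟨⟨run (run s L) L, L, run_run_run s L, ?_⟩,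
    FreeGroup.mk (FreeGroup.reduceCyclically.conjugator w.toWord), ?_⟩
  · rw [ReducedFrom, List.isChain_cons]
    refine ⟨fun y hy => ?_, hL.1⟩
    refine hL.2 _ ?_ y hy
    rw [run_fst]
    rcases h : L.getLast? with _ | z
    · rw [List.getLast?_eq_none_iff] at h
      simp [h] at hy
    · simp
  · rw [FreeGroup.inv_mk, FreeGroup.mul_mk, FreeGroup.mul_mk, hw, FreeGroup.mk_toWord]

theorem CyclicRun.isCyclicallyReduced (r : CyclicRun) : FreeGroup.IsCyclicallyReduced r.word := by
  have h := r.reduced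
  rw [ReducedFrom, List.isChain_cons] at h
  refine ⟨h.2, fun x hx y hy => ?_⟩
  have h1 := congrArg Prod.fst r.closed
  rw [run_fst, Option.mem_def.1 hx] at h1
  simp only [Option.getD_some] at h1
  rw [h1]
  exact h.1 y hy

/-! ### The step inequalities -/

theorem total_le_total {w w' : RunState → Letter → ℤ} (h : ∀ s x, w s x ≤ w' s x) (s : RunState)
    (L : List Letter) : total w s L ≤ total w' s L := by
  induction L generalizing s with
  | nil => exact le_rfl
  | cons x L ih => exact add_le_add (h s x) (ih _)

theorem total_add (w w' : RunState → Letter → ℤ) (s : RunState) (L : List Letter) :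
    total (fun s x => w s x + w' s x) s L = total w s L + total w' s L := by
  induction L generalizing s with
  | nil => rfl
  | cons x L ih => simp only [total, ih]; ring

theorem total_neg (w : RunState → Letter → ℤ) (s : RunState) (L : List Letter) :
    total (fun s x => -w s x) s L = -total w s L := by
  induction L generalizing s with
  | nil => rfl
  | cons x L ih => simp only [total, ih]; ring

namespace CyclicRun

theorem count_le_count {w w' : RunState → Letter → ℤ} (h : ∀ s x, w s x ≤ w' s x) (r : CyclicRun) :
    r.count w ≤ r.count w' := total_le_total h _ _

theorem count_add (w w' : RunState → Letter → ℤ) (r : CyclicRun) :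
    r.count (fun s x => w s x + w' s x) = r.count w + r.count w' := total_add _ _ _ _

theorem count_neg (w : RunState → Letter → ℤ) (r : CyclicRun) :
    r.count (fun s x => -w s x) = -r.count w := total_neg _ _ _

theorem count_neg' (w : RunState → Letter → ℤ) (r : CyclicRun) :
    r.count (-w) = -r.count w := total_neg _ _ _

theorem count_sub (w w' : RunState → Letter → ℤ) (r : CyclicRun) :
    r.count (fun s x => w s x - w' s x) = r.count w - r.count w' := by
  simp only [sub_eq_add_neg]
  rw [count_add w (fun s x => -w' s x), count_neg]

theorem count_two (w : RunState → Letter → ℤ) (r : CyclicRun) :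
    r.count (fun s x => 2 * w s x) = 2 * r.count w := by
  simp only [two_mul]; exact count_add w w r

theorem count_nonneg {w : RunState → Letter → ℤ} (h : ∀ s x, 0 ≤ w s x) (r : CyclicRun) :
    0 ≤ r.count w := by
  have h0 : r.count (fun _ _ => 0) = 0 := by
    have (s : RunState) (L : List Letter) : total (fun _ _ => 0) s L = 0 := by
      induction L generalizing s with
      | nil => rfl
      | cons x L ih => simp [total, ih]
    exact this _ _
  rw [← h0]; exact count_le_count h r

theorem length_word (r : CyclicRun) :
    (r.word.length : ℤ) = r.count (cnt 0) + r.count (cnt 1) := by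
  have (s : RunState) (L : List Letter) :
      (L.length : ℤ) = total (cnt 0) s L + total (cnt 1) s L := by
    induction L generalizing s with
    | nil => rfl
    | cons x L ih =>
      rw [List.length_cons, Nat.cast_succ, ih (next s x), total, total]
      have : cnt 0 s x + cnt 1 s x = 1 := by
        obtain ⟨j, p⟩ := x
        fin_cases j <;> simp [cnt]
      linarith
  exact this _ _

end CyclicRun

/-- The cyclic word `r'` is the image of `r` under `elem i`, together with all the relations between
their subword counts that the argument uses. -/
structure IsStep (i : Fin 2) (r r' : CyclicRun) : Prop where
  conj : ∃ g : F2, FreeGroup.mk r'.word = g * elem i (FreeGroup.mk r.word) * g⁻¹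
  cnt_rev : r'.count (cnt i.rev) = r.count (cnt i.rev)
  cnt_self : r'.count (cnt i) = r.count (cnt i) + r.count (cnt i.rev) - 2 * r.count peak
  peak : r'.count peak = r.count peak - r.count (opp1 i)
  opp_self : r'.count (opp i) ≤ r.count (opp i) - r.count (opp1 i)
  opp_rev : r'.count (opp i.rev) ≤ r.count (opp i.rev)
  opp1_rev_le : r'.count (opp1 i.rev) ≤ r.count (opp1 i.rev)
  le_opp1_rev : r.count (opp1 i.rev) ≤ r'.count (opp1 i.rev) + 2 * r.count (opp i)
  opp_rev_le_opp1 : r'.count (opp i.rev) ≤ r'.count (opp1 i.rev) + r.count (opp i)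
  flagged : r'.count flagged ≤ r.count flagged - r.count (opp i)

theorem exists_isStep (i : Fin 2) (r : CyclicRun) : ∃ r', IsStep i r r' := by
  obtain ⟨r', hg, H⟩ := exists_step i r
  refine ⟨r', hg, ?_, ?_, ?_, ?_, H _ _ _ (dominates_opp_rev i), H _ _ _ (dominates_opp1_rev i),
    ?_, ?_, ?_⟩
  · have h1 := H _ _ _ (dominates_cnt_rev i)
    have h2 := H _ _ _ (dominates_neg_cnt_rev i)
    simp only [CyclicRun.count_neg'] at h2
    omega
  · have h1 := H _ _ _ (dominates_cnt i)
    have h2 := H _ _ _ (dominates_neg_cnt i)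
    simp only [CyclicRun.count_neg', CyclicRun.count_neg, CyclicRun.count_sub, CyclicRun.count_add,
      CyclicRun.count_two] at h1 h2
    omega
  · have h1 := H _ _ _ (dominates_peak i)
    have h2 := H _ _ _ (dominates_neg_peak i)
    rw [CyclicRun.count_neg fun s x => F2.peak s x - opp1 i s x] at h2
    simp only [CyclicRun.count_neg', CyclicRun.count_sub] at h1 h2
    omega
  · have h1 := H _ _ _ (dominates_opp i)
    simp only [CyclicRun.count_sub] at h1
    exact h1
  · have h1 := H _ _ _ (dominates_neg_opp1_rev i)
    simp only [CyclicRun.count_neg', CyclicRun.count_sub, CyclicRun.count_two] at h1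
    omega
  · have h1 := H _ _ _ (dominates_opp_sub_opp1_rev i)
    simp only [CyclicRun.count_sub] at h1
    omega
  · have h1 := H _ _ _ (dominates_flagged i)
    simp only [CyclicRun.count_sub] at h1
    exact h1

/-! ### Stabilization of the number of peaks -/

theorem eq_or_eq_rev : ∀ j i : Fin 2, j = i ∨ j = i.rev := by decide

namespace CyclicRun

/-- A cyclic word representing the image of `r` under `elem i`. -/
noncomputable def step (i : Fin 2) (r : CyclicRun) : CyclicRun := (exists_isStep i r).choose

theorem isStep_step (i : Fin 2) (r : CyclicRun) : IsStep i r (r.step i) :=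
  (exists_isStep i r).choose_spec

/-- The cyclic word obtained by applying the automorphisms `elem i`, for `i` in `l`, in the order of
the list. -/
noncomputable def evolve (r : CyclicRun) (l : List (Fin 2)) : CyclicRun :=
  l.foldl (fun r i => r.step i) r

theorem evolve_append (r : CyclicRun) (l l' : List (Fin 2)) :
    r.evolve (l ++ l') = (r.evolve l).evolve l' := List.foldl_append

theorem evolve_cons (r : CyclicRun) (i : Fin 2) (l : List (Fin 2)) :
    r.evolve (i :: l) = (r.step i).evolve l := rfl

/-- The length of the cyclic word. -/
def len (r : CyclicRun) : ℤ := r.count (cnt 0) + r.count (cnt 1)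

/-- The increment of the length under `elem i`. -/
def inc (i : Fin 2) (r : CyclicRun) : ℤ := r.count (cnt i.rev) - 2 * r.count peak

theorem len_eq (i : Fin 2) (r : CyclicRun) :
    r.len = r.count (cnt i) + r.count (cnt i.rev) := by
  fin_cases i
  · rfl
  · exact add_comm _ _

theorem cnt_nonneg (i : Fin 2) (r : CyclicRun) : 0 ≤ r.count (cnt i) :=
  count_nonneg (fun s x => by unfold cnt; split <;> simp) r

theorem opp_nonneg (i : Fin 2) (r : CyclicRun) : 0 ≤ r.count (opp i) :=
  count_nonneg (fun s x => by unfold opp; split <;> simp) r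

theorem opp1_nonneg (i : Fin 2) (r : CyclicRun) : 0 ≤ r.count (opp1 i) :=
  count_nonneg (fun s x => by unfold opp1; split <;> simp) r

theorem opp1_le_opp (i : Fin 2) (r : CyclicRun) : r.count (opp1 i) ≤ r.count (opp i) :=
  count_le_count (fun s x => by unfold opp1 opp; split_ifs <;> simp_all) r

theorem flagged_nonneg (r : CyclicRun) : 0 ≤ r.count flagged :=
  count_nonneg (fun s x => by unfold flagged; split <;> simp) r

theorem flagged_le_len (r : CyclicRun) : r.count flagged ≤ r.len := by
  rw [len, ← count_add]
  refine count_le_count (fun s x => ?_) r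
  obtain ⟨j, p⟩ := x
  unfold flagged
  fin_cases j <;> simp [cnt] <;> split <;> simp

theorem len_step (i : Fin 2) (r : CyclicRun) : (r.step i).len = r.len + r.inc i := by
  have h := isStep_step i r
  have h1 := h.cnt_self
  have h2 := h.cnt_rev
  rw [len_eq i, len_eq i, inc]
  omega

theorem opp_step_eq_zero {i : Fin 2} {r : CyclicRun} (h : r.count (opp i) = 0) (j : Fin 2) :
    (r.step j).count (opp i) = 0 := by
  have hs := isStep_step j r
  have h0 := opp_nonneg i (r.step j)
  have h1 := opp1_nonneg i r
  obtain rfl | rfl := eq_or_eq_rev i j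
  · have := hs.opp_self; omega
  · have := hs.opp_rev; omega

theorem opp_evolve_eq_zero {i : Fin 2} {r : CyclicRun} (h : r.count (opp i) = 0)
    (l : List (Fin 2)) : (r.evolve l).count (opp i) = 0 := by
  induction l generalizing r with
  | nil => exact h
  | cons j l ih => exact ih (opp_step_eq_zero h j)

theorem peak_step_of_opp {i : Fin 2} {r : CyclicRun} (h : r.count (opp i) = 0) :
    (r.step i).count peak = r.count peak := by
  have h1 := opp1_nonneg i r
  have h2 := opp1_le_opp i r
  have h3 := (isStep_step i r).peak
  omega

theorem inc_step_of_opp {i : Fin 2} {r : CyclicRun} (h : r.count (opp i) = 0) :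
    (r.step i).inc i = r.inc i := by
  rw [inc, inc, peak_step_of_opp h, (isStep_step i r).cnt_rev]

theorem inc_rev_step_of_opp {i : Fin 2} {r : CyclicRun} (h : r.count (opp i) = 0) :
    (r.step i).inc i.rev = r.inc i.rev + r.inc i := by
  have := (isStep_step i r).cnt_self
  rw [inc, inc, inc, peak_step_of_opp h, Fin.rev_rev]
  omega

theorem evolve_replicate_of_opp {i : Fin 2} {r : CyclicRun} (h : r.count (opp i) = 0) (n : ℕ) :
    (r.evolve (List.replicate n i)).inc i = r.inc i ∧
      (r.evolve (List.replicate n i)).len = r.len + n * r.inc i := by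
  induction n generalizing r with
  | zero => simp [evolve]
  | succ n ih =>
    rw [List.replicate_succ, evolve_cons]
    obtain ⟨h1, h2⟩ := ih (opp_step_eq_zero h i)
    rw [h1, h2, inc_step_of_opp h, len_step]
    refine ⟨rfl, ?_⟩
    push_cast; ring

theorem len_nonneg (r : CyclicRun) : 0 ≤ r.len := add_nonneg (cnt_nonneg _ _) (cnt_nonneg _ _)

/-- Otherwise a constant negative increment would make the lengths under the powers of `elem i`
negative. -/
theorem inc_nonneg_of_opp {i : Fin 2} {r : CyclicRun} (h : r.count (opp i) = 0) : 0 ≤ r.inc i := by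
  by_contra! hneg
  have h1 := (evolve_replicate_of_opp h (r.len.toNat + 1)).2
  have h2 := len_nonneg (r.evolve (List.replicate (r.len.toNat + 1) i))
  have h3 := len_nonneg r
  push_cast at h1
  rw [Int.toNat_of_nonneg h3] at h1
  nlinarith

/-- There are no opposed runs of the generator `i`, and those of the other generator have length
one. The number of peaks is then constant under powers of `elem i`, and applying `elem i.rev` after
such a power removes all opposed runs at once. -/
structure Linear (i : Fin 2) (r : CyclicRun) : Prop where
  opp : r.count (opp i) = 0
  opp_rev : r.count (F2.opp i.rev) = r.count (opp1 i.rev)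

theorem linear_step_of_opp {i : Fin 2} {r : CyclicRun} (h : r.count (opp i) = 0) :
    (r.step i).Linear i := by
  have hs := isStep_step i r
  have h1 := hs.opp_rev_le_opp1
  have h2 := opp1_le_opp i.rev (r.step i)
  exact ⟨opp_step_eq_zero h i, by omega⟩

theorem opp1_rev_step {i : Fin 2} {r : CyclicRun} (h : r.count (opp i) = 0) :
    (r.step i).count (opp1 i.rev) = r.count (opp1 i.rev) := by
  have hs := isStep_step i r
  have h1 := hs.opp1_rev_le
  have h2 := hs.le_opp1_rev
  omega

/-- One step of the other generator removes all opposed runs of a linear word. -/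
theorem Linear.opp_step_rev {i : Fin 2} {r : CyclicRun} (h : r.Linear i) (j : Fin 2) :
    (r.step i.rev).count (F2.opp j) = 0 := by
  obtain rfl | rfl := eq_or_eq_rev j i
  · exact opp_step_eq_zero h.opp _
  · have h1 := (isStep_step i.rev r).opp_self
    have h2 := opp_nonneg i.rev (r.step i.rev)
    have h3 := h.opp_rev
    omega

theorem linear_of_opp {r : CyclicRun} (h : ∀ j, r.count (F2.opp j) = 0) (i : Fin 2) :
    r.Linear i := by
  have h1 := opp1_le_opp i.rev r
  have h2 := opp1_nonneg i.rev r
  have h3 := h i.rev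
  exact ⟨h i, by omega⟩

/-- Inserting one more factor `elem i` before `elem i.rev` changes the length and the increments by
multiples of `r.inc i`. -/
theorem Linear.step_rev_step {i : Fin 2} {r : CyclicRun} (h : r.Linear i) :
    ((r.step i).step i.rev).len = (r.step i.rev).len + (r.inc i + r.inc i) ∧
    ∀ j, ((r.step i).step i.rev).inc j = (r.step i.rev).inc j + r.inc i := by
  have hp : ((r.step i).step i.rev).count peak = (r.step i.rev).count peak := by
    rw [(isStep_step i.rev (r.step i)).peak, (isStep_step i.rev r).peak, peak_step_of_opp h.opp,
      opp1_rev_step h.opp]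
  refine ⟨?_, fun j => ?_⟩
  · rw [len_step, len_step, len_step, inc_rev_step_of_opp h.opp]
    ring
  · have h1 := (isStep_step i.rev (r.step i)).cnt_self
    have h2 := (isStep_step i.rev (r.step i)).cnt_rev
    have h3 := (isStep_step i r).cnt_self
    have h4 := (isStep_step i r).cnt_rev
    have h5 := (isStep_step i.rev r).cnt_self
    have h6 := (isStep_step i.rev r).cnt_rev
    have h7 := peak_step_of_opp h.opp
    rw [Fin.rev_rev] at h1 h2 h5 h6
    obtain rfl | rfl := eq_or_eq_rev j i
    · simp only [inc]; omega
    · simp only [inc, Fin.rev_rev]; omega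

/-- While opposed runs of both generators are present, every step decreases the number of flagged
letters. -/
theorem exists_opp_evolve_eq_zero (r : CyclicRun) (l : List (Fin 2))
    (h : r.count flagged ≤ l.length) : ∃ i, (r.evolve l).count (opp i) = 0 := by
  induction l generalizing r with
  | nil =>
    refine ⟨0, ?_⟩
    have h1 := (isStep_step 0 r).flagged
    have h2 := opp_nonneg 0 r
    have h3 := flagged_nonneg (r.step 0)
    simp only [List.length_nil, Nat.cast_zero] at h
    change r.count (opp 0) = 0
    omega
  | cons j l ih =>
    by_cases hj : r.count (opp j) = 0
    · exact ⟨j, opp_evolve_eq_zero hj _⟩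
    · refine ih (r.step j) ?_
      have h1 := (isStep_step j r).flagged
      have h2 := opp_nonneg j r
      push_cast [List.length_cons] at h
      omega

theorem opp_evolve_replicate_eq_zero (r : CyclicRun) (i : Fin 2) (n : ℕ)
    (h : r.count flagged ≤ n) : (r.evolve (List.replicate n i)).count (opp i) = 0 := by
  induction n generalizing r with
  | zero =>
    have h1 := (isStep_step i r).flagged
    have h2 := opp_nonneg i r
    have h3 := flagged_nonneg (r.step i)
    change r.count (opp i) = 0
    push_cast at h
    omega
  | succ n ih =>
    by_cases hj : r.count (opp i) = 0
    · exact opp_evolve_eq_zero hj _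
    · refine ih (r.step i) ?_
      have h1 := (isStep_step i r).flagged
      have h2 := opp_nonneg i r
      push_cast at h
      omega

theorem flagged_evolve_le (r : CyclicRun) (l : List (Fin 2)) :
    (r.evolve l).count flagged ≤ r.count flagged := by
  induction l generalizing r with
  | nil => exact le_rfl
  | cons i l ih =>
    have h1 := (isStep_step i r).flagged
    have h2 := opp_nonneg i r
    have := ih (r.step i)
    rw [evolve_cons]
    omega

theorem linear_evolve_replicate {i : Fin 2} {r : CyclicRun} (h : r.count (opp i) = 0) (n : ℕ) :
    (r.evolve (List.replicate (n + 1) i)).Linear i := by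
  induction n generalizing r with
  | zero => exact linear_step_of_opp h
  | succ n ih => exact ih (opp_step_eq_zero h i)

/-- A long power of one generator makes the word linear for that generator. -/
theorem linear_after_long_block {K : ℕ} (r : CyclicRun) (hr : r.count flagged ≤ (K + 1 : ℕ))
    (hopp : ∃ j, r.count (opp j) = 0) (i : Fin 2) :
    (r.evolve (List.replicate (K + 1) i)).Linear i := by
  obtain ⟨j, hj⟩ := hopp
  obtain rfl | rfl := eq_or_eq_rev j i
  · exact linear_evolve_replicate hj K
  · refine linear_of_opp (fun k => ?_) i
    obtain rfl | rfl := eq_or_eq_rev k i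
    · exact opp_evolve_replicate_eq_zero r _ _ hr
    · exact opp_evolve_eq_zero hj _

/-- If the opposed runs of one generator are absent, a power of one generator followed by one step
of the other makes the word linear for the latter. -/
theorem linear_after_turn (r : CyclicRun) (hopp : ∃ j, r.count (opp j) = 0) (i : Fin 2) (n : ℕ) :
    (r.evolve (List.replicate (n + 1) i ++ [i.rev])).Linear i.rev := by
  obtain ⟨j, hj⟩ := hopp
  rw [evolve_append]
  obtain rfl | rfl := eq_or_eq_rev j i
  · exact linear_of_opp (linear_evolve_replicate hj n).opp_step_rev _
  · exact linear_step_of_opp (opp_evolve_eq_zero hj _)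

end CyclicRun

/-! ### The cone spanned by the ratios -/

/-- The pair `(x, y)` satisfies `m * y ≤ x ≤ M * y`, which is stable under addition. -/
def InCone (m M : ℝ) (x y : ℤ) : Prop := m * y ≤ x ∧ x ≤ M * y

theorem InCone.add {m M : ℝ} {x y x' y' : ℤ} (h : InCone m M x y) (h' : InCone m M x' y') :
    InCone m M (x + x') (y + y') := by
  unfold InCone at *
  push_cast
  constructor <;> linarith [h.1, h.2, h'.1, h'.2]

open CyclicRun

/-- Without opposed runs, lengths and increments of all images are sums of the initial ones, with
coefficients that do not depend on the word. -/
theorem inCone_of_stable {m M : ℝ} {r s : CyclicRun} (hr : ∀ i, r.count (opp i) = 0)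
    (hs : ∀ i, s.count (opp i) = 0) (hlen : InCone m M r.len s.len)
    (hinc : ∀ i, InCone m M (r.inc i) (s.inc i)) (l : List (Fin 2)) :
    InCone m M (r.evolve l).len (s.evolve l).len := by
  induction l generalizing r s with
  | nil => exact hlen
  | cons i l ih =>
    refine ih (fun j => opp_step_eq_zero (hr j) i) (fun j => opp_step_eq_zero (hs j) i) ?_ ?_
    · rw [len_step, len_step]; exact hlen.add (hinc i)
    · intro j
      obtain rfl | rfl := eq_or_eq_rev j i
      · rw [inc_step_of_opp (hr _), inc_step_of_opp (hs _)]; exact hinc _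
      · rw [inc_rev_step_of_opp (hr _), inc_rev_step_of_opp (hs _)]
        exact (hinc _).add (hinc _)

/-- The powers of `elem i` add multiples of one increment to the lengths and increments before and
after the next change of generator; from then on `inCone_of_stable` applies. -/
theorem inCone_of_linear {m M : ℝ} {i : Fin 2} {r s : CyclicRun} (hr : r.Linear i)
    (hs : s.Linear i) (hlen : InCone m M r.len s.len) (hinc : InCone m M (r.inc i) (s.inc i))
    (hlen' : InCone m M (r.step i.rev).len (s.step i.rev).len)
    (hinc' : ∀ j, InCone m M ((r.step i.rev).inc j) ((s.step i.rev).inc j)) (l : List (Fin 2)) :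
    InCone m M (r.evolve l).len (s.evolve l).len := by
  induction l generalizing r s with
  | nil => exact hlen
  | cons j l ih =>
    obtain rfl | rfl := eq_or_eq_rev j i
    · refine ih (linear_step_of_opp hr.opp) (linear_step_of_opp hs.opp) ?_ ?_ ?_ ?_
      · rw [len_step, len_step]; exact hlen.add hinc
      · rw [inc_step_of_opp hr.opp, inc_step_of_opp hs.opp]; exact hinc
      · rw [hr.step_rev_step.1, hs.step_rev_step.1]; exact hlen'.add (hinc.add hinc)
      · intro k
        rw [hr.step_rev_step.2, hs.step_rev_step.2]; exact (hinc' k).add hinc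
    · exact inCone_of_stable hr.opp_step_rev hs.opp_step_rev hlen' hinc' l

/-- A list over two letters splits off its initial power of `i`. -/
theorem exists_replicate_append (i : Fin 2) (l : List (Fin 2)) :
    ∃ n l', l = List.replicate n i ++ l' ∧ (l' = [] ∨ ∃ l'', l' = i.rev :: l'') := by
  induction l with
  | nil => exact ⟨0, [], rfl, Or.inl rfl⟩
  | cons j l ih =>
    obtain rfl | rfl := eq_or_eq_rev j i
    · obtain ⟨n, l', rfl, h⟩ := ih
      exact ⟨n + 1, l', rfl, h⟩
    · exact ⟨0, _, rfl, Or.inr ⟨l, rfl⟩⟩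

/-- If the pairs of lengths, and those pairs of increments that belong to a power acting linearly on
both words, lie in the cone after all short lists of steps, then all pairs of lengths do. -/
theorem inCone_evolve {m M : ℝ} {K N : ℕ} (hN : 2 * K + 3 ≤ N) {r s : CyclicRun}
    (hr : r.count flagged ≤ (K + 1 : ℕ)) (hs : s.count flagged ≤ (K + 1 : ℕ))
    (hlen : ∀ l : List (Fin 2), l.length ≤ N → InCone m M (r.evolve l).len (s.evolve l).len)
    (hinc : ∀ l : List (Fin 2), l.length ≤ N → ∀ i, (r.evolve l).count (opp i) = 0 →
      (s.evolve l).count (opp i) = 0 → InCone m M ((r.evolve l).inc i) ((s.evolve l).inc i))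
    (l : List (Fin 2)) : InCone m M (r.evolve l).len (s.evolve l).len := by
  have base (p : List (Fin 2)) (i : Fin 2) (hp : p.length + 1 ≤ N) (h1 : (r.evolve p).Linear i)
      (h2 : (s.evolve p).Linear i) (l : List (Fin 2)) :
      InCone m M (r.evolve (p ++ l)).len (s.evolve (p ++ l)).len := by
    have hstep (r : CyclicRun) : (r.evolve p).step i.rev = r.evolve (p ++ [i.rev]) :=
      (evolve_append r p [i.rev]).symm
    have hp' : (p ++ [i.rev]).length ≤ N := by simpa using hp
    rw [evolve_append, evolve_append]
    refine inCone_of_linear h1 h2 (hlen p (by omega)) (hinc p (by omega) i h1.opp h2.opp) ?_ ?_ l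
    · rw [hstep, hstep]; exact hlen _ hp'
    · intro j
      have h3 := h1.opp_step_rev j
      have h4 := h2.opp_step_rev j
      rw [hstep] at h3 h4 ⊢
      rw [hstep]
      exact hinc _ hp' j h3 h4
  by_cases hl : l.length ≤ N
  · exact hlen l hl
  -- After `K + 1` steps, each of the two words has lost the opposed runs of one generator.
  set p := l.take (K + 1) with hp
  have hpl : p.length = K + 1 := by rw [hp, List.length_take]; omega
  have hr0 := exists_opp_evolve_eq_zero r p (by rw [hpl]; exact hr)
  have hs0 := exists_opp_evolve_eq_zero s p (by rw [hpl]; exact hs)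
  rcases hq : l.drop (K + 1) with _ | ⟨i, q⟩
  · rw [List.drop_eq_nil_iff] at hq; omega
  have hl1 : l = p ++ (i :: q) := by rw [hp, ← hq, List.take_append_drop]
  obtain ⟨n, q', rfl, hq'⟩ := exists_replicate_append i q
  rw [← List.cons_append, ← List.replicate_succ] at hl1
  -- The next block is a power of `i`. If it is long, both words are linear for `i` after `K + 1` of
  -- its letters; if it is short, they are linear for the other generator right after the next turn.
  by_cases hn : K ≤ n
  · obtain ⟨t, rfl⟩ := Nat.exists_eq_add_of_le hn
    have hl2 : l = (p ++ List.replicate (K + 1) i) ++ (List.replicate t i ++ q') := by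
      rw [hl1, show K + t + 1 = (K + 1) + t by ring, List.replicate_add]
      simp only [List.append_assoc]
    rw [hl2]
    refine base _ i (by simp [hpl]; omega) ?_ ?_ _
    · rw [evolve_append]
      exact linear_after_long_block _ ((flagged_evolve_le _ _).trans hr) hr0 i
    · rw [evolve_append]
      exact linear_after_long_block _ ((flagged_evolve_le _ _).trans hs) hs0 i
  · rcases hq' with rfl | ⟨q'', rfl⟩
    · exfalso
      apply hl
      rw [hl1]
      simp [hpl]
      omega
    · have hl2 : l = (p ++ (List.replicate (n + 1) i ++ [i.rev])) ++ q'' := by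
        rw [hl1]; simp
      rw [hl2]
      refine base _ i.rev (by simp [hpl]; omega) ?_ ?_ _
      · rw [evolve_append]; exact linear_after_turn _ hr0 i n
      · rw [evolve_append]; exact linear_after_turn _ hs0 i n

/-! ### Nielsen reduction -/

/-- The length of the longest common prefix. -/
def commonPrefix : List Letter → List Letter → ℕ
  | x :: L, y :: L' => if x = y then commonPrefix L L' + 1 else 0
  | _, _ => 0

theorem commonPrefix_comm (L L' : List Letter) : commonPrefix L L' = commonPrefix L' L := by
  induction L generalizing L' with
  | nil => cases L' <;> simp [commonPrefix]
  | cons x L ih =>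
    cases L' with
    | nil => simp [commonPrefix]
    | cons y L' => simp [commonPrefix, ih L', eq_comm]

theorem min_commonPrefix_le (L M N : List Letter) :
    min (commonPrefix L M) (commonPrefix M N) ≤ commonPrefix L N := by
  induction M generalizing L N with
  | nil => cases L <;> simp [commonPrefix]
  | cons y M ih =>
    rcases L with _ | ⟨x, L⟩
    · simp [commonPrefix]
    rcases N with _ | ⟨z, N⟩
    · simp [commonPrefix]
    by_cases h1 : x = y
    · by_cases h2 : y = z
      · subst h1; subst h2
        have := ih L N
        simp only [commonPrefix, if_true]
        omega
      · simp [commonPrefix, h2]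
    · simp [commonPrefix, h1]

theorem take_eq_take_of_le_commonPrefix {L M : List Letter} {k : ℕ} (h : k ≤ commonPrefix L M) :
    L.take k = M.take k := by
  induction L generalizing M k with
  | nil => simp [commonPrefix] at h; simp [h]
  | cons x L ih =>
    rcases M with _ | ⟨y, M⟩
    · simp [commonPrefix] at h; simp [h]
    rcases k with _ | k
    · simp
    by_cases hxy : x = y
    · subst hxy
      simp only [commonPrefix, if_true] at h
      simp [ih (Nat.le_of_succ_le_succ h)]
    · simp [commonPrefix, hxy] at h

open FreeGroup in
/-- In `L⁻¹ M` exactly the common prefix cancels. -/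
theorem norm_inv_mul_mk {L M : List Letter} (hL : IsReduced L) (hM : IsReduced M) :
    ((mk L)⁻¹ * mk M).norm + 2 * commonPrefix L M = L.length + M.length := by
  have hnorm {L : List Letter} (h : IsReduced L) : (mk L).norm = L.length := by
    rw [FreeGroup.norm, toWord_mk, h.reduce_eq]
  induction L generalizing M with
  | nil =>
    have : mk ([] : List Letter) = 1 := rfl
    simp [commonPrefix, this, hnorm hM]
  | cons x L ih =>
    rcases M with _ | ⟨y, M⟩
    · have : mk ([] : List Letter) = 1 := rfl
      rw [this, mul_one, norm_inv_eq, hnorm hL]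
      simp [commonPrefix]
    by_cases hxy : x = y
    · subst hxy
      have hcons (L : List Letter) : mk (x :: L) = mk [x] * mk L := by simp [mul_mk]
      have := ih (hL.infix ⟨[x], [], by simp⟩) (hM.infix (L₁ := M) ⟨[x], [], by simp⟩)
      rw [hcons L, hcons M, mul_inv_rev, mul_assoc, inv_mul_cancel_left]
      simp only [commonPrefix, if_true, List.length_cons]
      omega
    · have hred : IsReduced (invRev (x :: L) ++ y :: M) := by
        have h1 : IsReduced (invRev (x :: L)) := by
          have := reduce_invRev (w := x :: L)
          rw [hL.reduce_eq] at this
          exact IsReduced.of_reduce_eq this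
        refine List.IsChain.append h1 hM fun u hu v hv => ?_
        simp [invRev] at hu hv
        subst hu; subst hv
        intro h
        simp only at h ⊢
        have : x.2 ≠ y.2 := fun h' => hxy (Prod.ext h h')
        revert this
        cases x.2 <;> cases y.2 <;> simp
      rw [inv_mk, mul_mk, hnorm hred]
      simp [commonPrefix, hxy, invRev_length]

/-- The Gromov product in the Cayley tree: the length of the common prefix of the reduced words. -/
def gromov (g h : F2) : ℕ := commonPrefix g.toWord h.toWord

theorem gromov_comm (g h : F2) : gromov g h = gromov h g := commonPrefix_comm _ _

/-- The Cayley tree is `0`-hyperbolic. -/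
theorem min_gromov_le (f g h : F2) : min (gromov f g) (gromov g h) ≤ gromov f h :=
  min_commonPrefix_le _ _ _

theorem norm_inv_mul (g h : F2) : (g⁻¹ * h).norm + 2 * gromov g h = g.norm + h.norm := by
  have := norm_inv_mul_mk (FreeGroup.isReduced_toWord (x := g))
    (FreeGroup.isReduced_toWord (x := h))
  rwa [FreeGroup.mk_toWord, FreeGroup.mk_toWord] at this

theorem two_mul_gromov_inv_lt {g : F2} (hg : g ≠ 1) : 2 * gromov g g⁻¹ < g.norm := by
  have h1 := norm_inv_mul g g⁻¹
  obtain ⟨c, hc⟩ := exists_norm_pow g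
  have h2 := hc 0
  have h3 := hc 1
  have h4 := cycLen_pos hg
  have h5 : (g⁻¹ * g⁻¹).norm = (g ^ (1 + 1)).norm := by
    rw [← FreeGroup.norm_inv_eq]; congr 1; group
  rw [FreeGroup.norm_inv_eq] at h1
  rw [zero_add, pow_one] at h2
  omega

/-- The inverse letter. -/
abbrev invLetter (x : Letter) : Letter := (x.1, !x.2)

theorem invLetter_ne : ∀ x : Letter, invLetter x ≠ x := by decide

theorem mk_invLetter (x : Letter) : (FreeGroup.mk [invLetter x] : F2) = (FreeGroup.mk [x])⁻¹ := by
  simp [FreeGroup.inv_mk, FreeGroup.invRev]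

/-- If the images of the letters are Nielsen reduced, that is, if in a product no factor is
cancelled completely by its two neighbours, then the image of a reduced word is at least as
long as the word. The stronger statement, which is needed for the induction, says that the image of `x :: L`
branches off from the image of another letter `y` no later than the image of `x` does. -/
theorem length_le_norm_map (φ : MulAut F2)
    (h : ∀ x y y' : Letter, y ≠ x → y' ≠ invLetter x →
      gromov (φ (FreeGroup.mk [x])) (φ (FreeGroup.mk [y])) +
        gromov (φ (FreeGroup.mk [invLetter x])) (φ (FreeGroup.mk [y'])) <
          (φ (FreeGroup.mk [x])).norm)
    (x : Letter) (L : List Letter) (hL : FreeGroup.IsReduced (x :: L)) (y : Letter) (hy : y ≠ x) :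
    gromov (φ (FreeGroup.mk (x :: L))) (φ (FreeGroup.mk [y])) ≤
        gromov (φ (FreeGroup.mk [x])) (φ (FreeGroup.mk [y])) ∧
      (x :: L).length + gromov (φ (FreeGroup.mk [x])) (φ (FreeGroup.mk [y])) ≤
        (φ (FreeGroup.mk (x :: L))).norm := by
  have hinv_letter : ∀ x : Letter, x ≠ invLetter x := by decide
  induction L generalizing x y with
  | nil =>
    have := h x y x hy (hinv_letter x)
    exact ⟨le_rfl, by simp only [List.length_cons, List.length_nil]; omega⟩
  | cons z L ih =>
    have hz : z ≠ invLetter x := by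
      rintro rfl
      have := (List.isChain_cons_cons.1 hL).1 rfl
      simp at this
    set P := φ (FreeGroup.mk (z :: L))
    have hP : φ (FreeGroup.mk (x :: z :: L)) = φ (FreeGroup.mk [x]) * P := by
      rw [← map_mul, FreeGroup.mul_mk]; rfl
    have hinv : φ (FreeGroup.mk [invLetter x]) = (φ (FreeGroup.mk [x]))⁻¹ := by
      rw [mk_invLetter, map_inv]
    obtain ⟨h1, h2⟩ := ih z (hL.infix ⟨[x], [], by simp⟩) (invLetter x) hz.symm
    change _ ≤ P.norm at h2
    have h3 := h x y z hy hz
    have h4 := norm_inv_mul (φ (FreeGroup.mk [invLetter x])) P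
    have h5 := norm_inv_mul (φ (FreeGroup.mk [x])) (φ (FreeGroup.mk (x :: z :: L)))
    have h6 := min_gromov_le (φ (FreeGroup.mk [x])) (φ (FreeGroup.mk (x :: z :: L)))
      (φ (FreeGroup.mk [y]))
    rw [gromov_comm P, gromov_comm (φ (FreeGroup.mk [z]))] at h1
    rw [gromov_comm (φ (FreeGroup.mk [z]))] at h2
    rw [hinv] at h1 h2 h3 h4
    rw [inv_inv, FreeGroup.norm_inv_eq] at h4
    rw [hP] at h5 h6 ⊢
    rw [inv_mul_cancel_left] at h5
    simp only [List.length_cons] at h2 ⊢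
    constructor <;> omega

/-- The total length of the images of the basis. -/
def size (φ : MulAut F2) : ℕ := (φ a).norm + (φ b).norm

theorem size_eq (φ : MulAut F2) {x y : Letter} (hxy : x.1 ≠ y.1) :
    size φ = (φ (FreeGroup.mk [x])).norm + (φ (FreeGroup.mk [y])).norm := by
  have key (i : Fin 2) (p : Bool) :
      (φ (FreeGroup.mk [(i, p)])).norm = (φ (FreeGroup.of i)).norm := by
    cases p
    · rw [show ((i, false) : Letter) = invLetter (i, true) from rfl, mk_invLetter, map_inv,
        FreeGroup.norm_inv_eq]; rfl
    · rfl
  obtain ⟨i, p⟩ := x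
  obtain ⟨j, q⟩ := y
  rw [key, key, size, a, b]
  fin_cases i <;> fin_cases j <;> simp_all [add_comm]

theorem elem_inv_of_rev (i : Fin 2) :
    (elem i)⁻¹ (FreeGroup.of i.rev) = FreeGroup.of i.rev * (FreeGroup.of i)⁻¹ := by
  rw [MulAut.inv_apply, MulEquiv.symm_apply_eq, map_mul, map_inv, elem_of_rev, elem_of_self]
  simp

theorem elem_inv_of_self (i : Fin 2) : (elem i)⁻¹ (FreeGroup.of i) = FreeGroup.of i := by
  rw [MulAut.inv_apply, MulEquiv.symm_apply_eq, elem_of_self]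

/-- Replacing the image of `y` by its product with the image of `x`, and conjugating by `g`, is
right multiplication by `elem x.1` or its inverse, up to an inner automorphism. -/
theorem exists_nielsen_move (φ : MulAut F2) {x y : Letter} (hxy : x.1 ≠ y.1) (g : F2) :
    ∃ (g' : F2) (p : Bool),
      size (MulAut.conj g' * φ * (if p then elem x.1 else (elem x.1)⁻¹)) =
        (g * φ (FreeGroup.mk [x]) * g⁻¹).norm +
          (g * (φ (FreeGroup.mk [y]) * φ (FreeGroup.mk [x])) * g⁻¹).norm := by
  have hof (j : Fin 2) : (FreeGroup.mk [(j, true)] : F2) = FreeGroup.of j := rfl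
  have hinv (j : Fin 2) : (FreeGroup.mk [(j, false)] : F2) = (FreeGroup.of j)⁻¹ := rfl
  obtain ⟨i, p⟩ := x
  obtain ⟨j, q⟩ := y
  obtain rfl : j = i.rev := (eq_or_eq_rev j i).resolve_left fun h => hxy h.symm
  have hsz (θ : MulAut F2) : size θ = (θ (FreeGroup.of i)).norm + (θ (FreeGroup.of i.rev)).norm :=
    size_eq θ (x := (i, true)) (y := (i.rev, true)) hxy
  have hel (p : Bool) : (if p then elem i else (elem i)⁻¹) (FreeGroup.of i) = FreeGroup.of i := by
    cases p
    · exact elem_inv_of_self i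
    · exact elem_of_self i
  have hel' (p : Bool) : (if p then elem i else (elem i)⁻¹) (FreeGroup.of i.rev) =
      FreeGroup.of i.rev * FreeGroup.mk [(i, p)] := by
    cases p
    · exact elem_inv_of_rev i
    · exact elem_of_rev i
  have hfl : FreeGroup.mk [(i, !p)] = (FreeGroup.mk [(i, p)])⁻¹ := mk_invLetter (i, p)
  have hn (g : F2) : (g * φ (FreeGroup.mk [(i, p)]) * g⁻¹).norm =
      (g * φ (FreeGroup.of i) * g⁻¹).norm := by
    cases p
    · rw [hinv, ← FreeGroup.norm_inv_eq, map_inv]; congr 1; group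
    · rfl
  cases q
  · refine ⟨g * (φ (FreeGroup.mk [(i, p)]))⁻¹, !p, ?_⟩
    rw [hsz, hn]
    simp only [MulAut.mul_apply, hel, hel', MulAut.conj_apply]
    congr 1
    · congr 1
      have : Commute (φ (FreeGroup.mk [(i, p)])) (φ (FreeGroup.of i)) := by
        cases p
        · rw [hinv, map_inv]; exact (Commute.refl _).inv_left
        · exact Commute.refl _
      have h2 := this.inv_left.eq
      rw [mul_assoc g, h2]
      group
    · rw [← FreeGroup.norm_inv_eq, hfl, hinv, map_mul, map_inv, map_inv]; congr 1; group
  · refine ⟨g, p, ?_⟩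
    rw [hsz, hn]
    simp only [MulAut.mul_apply, hel, hel', MulAut.conj_apply, hof, map_mul φ]

theorem take_invRev (L : List Letter) (k : ℕ) :
    (FreeGroup.invRev L).take k = FreeGroup.invRev (L.drop (L.length - k)) := by
  simp [FreeGroup.invRev, List.take_reverse, List.map_drop]

/-- A basis whose total length cannot be decreased by a Nielsen move and a conjugation is Nielsen
reduced. -/
theorem nielsen_reduced {φ : MulAut F2}
    (hφ : ∀ (g : F2) (i : Fin 2) (p : Bool),
      size φ ≤ size (MulAut.conj g * φ * (if p then elem i else (elem i)⁻¹)))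
    (x y y' : Letter) (hy : y ≠ x) (hy' : y' ≠ invLetter x) :
    gromov (φ (FreeGroup.mk [x])) (φ (FreeGroup.mk [y])) +
      gromov (φ (FreeGroup.mk [invLetter x])) (φ (FreeGroup.mk [y'])) <
        (φ (FreeGroup.mk [x])).norm := by
  have hinv_letter (x : Letter) : φ (FreeGroup.mk [invLetter x]) = (φ (FreeGroup.mk [x]))⁻¹ := by
    rw [mk_invLetter, map_inv]
  have hmove (x y : Letter) (hxy : x.1 ≠ y.1) (g : F2) :
      (φ (FreeGroup.mk [x])).norm + (φ (FreeGroup.mk [y])).norm ≤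
        (g * φ (FreeGroup.mk [x]) * g⁻¹).norm +
          (g * (φ (FreeGroup.mk [y]) * φ (FreeGroup.mk [x])) * g⁻¹).norm := by
    obtain ⟨g', p, h⟩ := exists_nielsen_move φ hxy g
    rw [← size_eq φ hxy, ← h]
    exact hφ _ _ _
  have hle (x y : Letter) (hxy : x.1 ≠ y.1) :
      2 * gromov (φ (FreeGroup.mk [x])) (φ (FreeGroup.mk [y])) ≤ (φ (FreeGroup.mk [x])).norm ∧
      2 * gromov (φ (FreeGroup.mk [x])) (φ (FreeGroup.mk [y])) ≤ (φ (FreeGroup.mk [y])).norm := by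
    have h1 := norm_inv_mul (φ (FreeGroup.mk [x])) (φ (FreeGroup.mk [y]))
    have h2 := hmove y (invLetter x) hxy.symm 1
    have h3 := hmove x (invLetter y) hxy 1
    rw [hinv_letter, FreeGroup.norm_inv_eq] at h2 h3
    simp only [one_mul, inv_one, mul_one] at h2 h3
    rw [← FreeGroup.norm_inv_eq (x := _⁻¹ * φ (FreeGroup.mk [x])), mul_inv_rev, inv_inv] at h3
    omega
  have hne : φ (FreeGroup.mk [x]) ≠ 1 := by
    intro h
    rw [EmbeddingLike.map_eq_one_iff, ← FreeGroup.toWord_eq_nil_iff, FreeGroup.toWord_mk,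
      FreeGroup.reduce_singleton] at h
    simp at h
  have hself := two_mul_gromov_inv_lt hne
  have hcases : ∀ x y : Letter, y ≠ x → y = invLetter x ∨ x.1 ≠ y.1 := by decide
  have hcases' : ∀ x y : Letter, y ≠ invLetter x → y = x ∨ x.1 ≠ y.1 := by decide
  have hcases'' : ∀ x y y' : Letter, x.1 ≠ y.1 → x.1 ≠ y'.1 → y' = y ∨ y' = invLetter y := by decide
  have hA : y = invLetter x ∨ x.1 ≠ y.1 := hcases x y hy
  have hB : y' = x ∨ x.1 ≠ y'.1 := hcases' x y' hy'
  have e1 : 2 * gromov (φ (FreeGroup.mk [x])) (φ (FreeGroup.mk [y])) ≤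
      (φ (FreeGroup.mk [x])).norm := by
    rcases hA with rfl | h
    · rw [hinv_letter]; omega
    · exact (hle x y h).1
  have e2 : 2 * gromov (φ (FreeGroup.mk [invLetter x])) (φ (FreeGroup.mk [y'])) ≤
      (φ (FreeGroup.mk [x])).norm := by
    rcases hB with rfl | h
    · rw [hinv_letter, gromov_comm]; omega
    · have := (hle (invLetter x) y' h).1
      rwa [hinv_letter, FreeGroup.norm_inv_eq, ← hinv_letter] at this
  by_contra! hge
  replace hA : x.1 ≠ y.1 := by
    rcases hA with rfl | h
    · rw [← hinv_letter] at hself; omega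
    · exact h
  replace hB : x.1 ≠ y'.1 := by
    rcases hB with rfl | h
    · rw [← hinv_letter, gromov_comm] at hself; omega
    · exact h
  -- The image of `x` is cancelled completely, one half from each side. If both halves cancel
  -- against the same letter, then the image of `x` and its inverse agree on half of their letters.
  -- If they cancel against `y` and `y⁻¹`, the images are `p q` and `p r q`, and conjugating by `p`
  -- yields the shorter pair `q p`, `r`.
  rcases hcases'' x y y' hA hB with rfl | rfl
  · have := min_gromov_le (φ (FreeGroup.mk [x])) (φ (FreeGroup.mk [y']))
      (φ (FreeGroup.mk [invLetter x]))
    rw [gromov_comm (φ (FreeGroup.mk [y']))] at this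
    rw [← hinv_letter] at hself
    omega
  · set X := φ (FreeGroup.mk [x]) with hX
    set Y := φ (FreeGroup.mk [y]) with hY
    rw [hinv_letter, hinv_letter, ← hX, ← hY] at hge e2
    set k := gromov X Y with hk
    have hk2 : gromov X⁻¹ Y⁻¹ = k := by omega
    have hXk : X.norm = 2 * k := by omega
    have hYk : 2 * k ≤ Y.norm := (hle x y hA).2
    have hkpos : 0 < k := by omega
    have t1 : X.toWord.take k = Y.toWord.take k := take_eq_take_of_le_commonPrefix hk.le
    have t2 := take_eq_take_of_le_commonPrefix (L := X⁻¹.toWord) (M := Y⁻¹.toWord) hk2.ge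
    have t3 : X.toWord.drop k = Y.toWord.drop (Y.norm - k) := by
      rw [FreeGroup.toWord_inv, FreeGroup.toWord_inv, take_invRev, take_invRev] at t2
      have hlen : X.toWord.length - k = k := by change X.norm - k = k; omega
      rw [hlen] at t2
      exact FreeGroup.invRev_injective t2
    set p : F2 := FreeGroup.mk (X.toWord.take k)
    set q : F2 := FreeGroup.mk (X.toWord.drop k)
    set r : F2 := FreeGroup.mk ((Y.toWord.take (Y.norm - k)).drop k)
    have hXpq : X = p * q := by
      rw [FreeGroup.mul_mk, List.take_append_drop, FreeGroup.mk_toWord]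
    have hYprq : Y = p * r * q := by
      have h1 : X.toWord.take k = (Y.toWord.take (Y.norm - k)).take k := by
        rw [t1, List.take_take, min_eq_left (by omega)]
      rw [FreeGroup.mul_mk, FreeGroup.mul_mk, t3, h1, List.take_append_drop,
        List.take_append_drop, FreeGroup.mk_toWord]
    have hp : p.norm ≤ k := FreeGroup.norm_mk_le.trans (by simp)
    have hq : q.norm ≤ k := FreeGroup.norm_mk_le.trans (by
      rw [List.length_drop]; change X.norm - k ≤ k; omega)
    have hr : r.norm ≤ Y.norm - 2 * k := FreeGroup.norm_mk_le.trans (by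
      rw [List.length_drop, List.length_take]; change min _ Y.norm - k ≤ _; omega)
    have hfin := hmove (invLetter x) y hA p⁻¹
    rw [hinv_letter, ← hX, ← hY, FreeGroup.norm_inv_eq] at hfin
    have h1 : (p⁻¹ * X⁻¹ * p⁻¹⁻¹).norm ≤ 2 * k := by
      rw [← FreeGroup.norm_inv_eq, show (p⁻¹ * X⁻¹ * p⁻¹⁻¹)⁻¹ = q * p by rw [hXpq]; group]
      exact (FreeGroup.norm_mul_le q p).trans (by omega)
    have h2 : p⁻¹ * (Y * X⁻¹) * p⁻¹⁻¹ = r := by rw [hXpq, hYprq]; group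
    rw [h2] at hfin
    omega

/-! ### Every automorphism is a chain -/

/-- The automorphisms that preserve the cyclic length of every element. -/
def isometries : Subgroup (MulAut F2) where
  carrier := {π | ∀ w, cycLen (π w) = cycLen w}
  one_mem' _ := rfl
  mul_mem' {π θ} hπ hθ w := by rw [MulAut.mul_apply, hπ, hθ]
  inv_mem' {π} hπ w := by rw [← hπ (π⁻¹ w), MulAut.apply_inv_self]

/-- Signed permutations of the basis preserve the cyclic length. -/
theorem mem_isometries_of_letters {θ : MulAut F2} (h : ∀ i, ∃ y : Letter,
    θ (FreeGroup.of i) = FreeGroup.mk [y]) : θ ∈ isometries := by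
  have hinj : ∀ x y : Letter, (FreeGroup.mk [x] : F2) = FreeGroup.mk [y] → x = y := by
    intro x y hxy
    have := congrArg FreeGroup.toWord hxy
    simpa [FreeGroup.toWord_mk, FreeGroup.reduce_singleton] using this
  have h' (x : Letter) : ∃ y : Letter, θ (FreeGroup.mk [x]) = FreeGroup.mk [y] := by
    obtain ⟨i, p⟩ := x
    obtain ⟨y, hy⟩ := h i
    cases p
    · refine ⟨invLetter y, ?_⟩
      rw [show ((i, false) : Letter) = invLetter (i, true) from rfl, mk_invLetter, mk_invLetter,
        map_inv, ← hy]
      rfl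
    · exact ⟨y, hy⟩
  choose f hf using h'
  have hinv_letter (x : Letter) : f (invLetter x) = invLetter (f x) := by
    apply hinj
    rw [← hf, mk_invLetter, mk_invLetter, map_inv, hf]
  have hfinj : Function.Injective f := fun x y hxy => hinj x y <| θ.injective <| by rw [hf, hf, hxy]
  have hmap (L : List Letter) : θ (FreeGroup.mk L) = FreeGroup.mk (L.map f) := by
    induction L with
    | nil => exact map_one θ
    | cons x L ih =>
      have hc (x : Letter) (L : List Letter) :
          (FreeGroup.mk (x :: L) : F2) = FreeGroup.mk [x] * FreeGroup.mk L := by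
        simp [FreeGroup.mul_mk]
      rw [hc, map_mul, ih, hf, List.map_cons, ← hc]
  have hiff : ∀ x y : Letter, (x.1 = y.1 → x.2 = y.2) ↔ y ≠ invLetter x := by decide
  have hrel (x y : Letter) (hxy : x.1 = y.1 → x.2 = y.2) :
      (f x).1 = (f y).1 → (f x).2 = (f y).2 := by
    rw [hiff] at hxy ⊢
    rw [← hinv_letter]
    exact fun h => hxy (hfinj h)
  intro w
  obtain ⟨r, g, rfl⟩ := exists_cyclicRun w
  have hr := r.isCyclicallyReduced
  have hr' : FreeGroup.IsCyclicallyReduced (r.word.map f) := by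
    refine ⟨?_, fun x hx y hy => ?_⟩
    · exact (List.isChain_map f).2 (hr.1.imp hrel)
    · rw [List.getLast?_map, Option.mem_map] at hx
      rw [List.head?_map, Option.mem_map] at hy
      obtain ⟨x, hx, rfl⟩ := hx
      obtain ⟨y, hy, rfl⟩ := hy
      exact hrel x y (hr.2 x hx y hy)
  rw [map_mul, map_mul, map_inv, cycLen_conj, cycLen_conj, hmap,
    cycLen_mk_of_isCyclicallyReduced hr, cycLen_mk_of_isCyclicallyReduced hr', List.length_map]

/-- An automorphism whose letter images are Nielsen reduced does not shorten words, so its inverse maps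
letters to letters. -/
theorem mem_isometries_of_nielsen_reduced {φ : MulAut F2}
    (h : ∀ x y y' : Letter, y ≠ x → y' ≠ invLetter x →
      gromov (φ (FreeGroup.mk [x])) (φ (FreeGroup.mk [y])) +
        gromov (φ (FreeGroup.mk [invLetter x])) (φ (FreeGroup.mk [y'])) <
          (φ (FreeGroup.mk [x])).norm) :
    φ ∈ isometries := by
  rw [← inv_mem_iff]
  refine mem_isometries_of_letters fun i => ?_
  have hred : FreeGroup.IsReduced (φ⁻¹ (FreeGroup.of i)).toWord := FreeGroup.isReduced_toWord
  have hmk : FreeGroup.mk (φ⁻¹ (FreeGroup.of i)).toWord = φ⁻¹ (FreeGroup.of i) :=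
    FreeGroup.mk_toWord
  rcases hL : (φ⁻¹ (FreeGroup.of i)).toWord with _ | ⟨x, L⟩
  · rw [FreeGroup.toWord_eq_nil_iff, EmbeddingLike.map_eq_one_iff] at hL
    exact absurd hL (FreeGroup.of_ne_one i)
  · rw [hL] at hred hmk
    have h1 := (length_le_norm_map φ h x L hred (invLetter x) (invLetter_ne x)).2
    rw [hmk, MulAut.apply_inv_self, FreeGroup.norm_of, List.length_cons] at h1
    obtain rfl : L = [] := List.length_eq_zero_iff.1 (by omega)
    exact ⟨x, hmk.symm⟩

/-- Induction on automorphisms along Nielsen reduction: isometries, inner automorphisms and the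
`elem i` generate the automorphism group. -/
theorem aut_induction {P : MulAut F2 → Prop} (isom : ∀ φ ∈ isometries, P φ)
    (conj : ∀ φ g, P (MulAut.conj g * φ) → P φ)
    (elem_mul : ∀ φ i, P (φ * elem i) → P φ) (elem_inv_mul : ∀ φ i, P (φ * (elem i)⁻¹) → P φ)
    (φ : MulAut F2) : P φ := by
  induction hn : size φ using Nat.strong_induction_on generalizing φ with
  | _ n ih =>
    by_cases h : ∀ (g : F2) (i : Fin 2) (p : Bool),
      size φ ≤ size (MulAut.conj g * φ * (if p then elem i else (elem i)⁻¹))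
    · exact isom φ (mem_isometries_of_nielsen_reduced (nielsen_reduced h))
    · push Not at h
      obtain ⟨g, i, p, h⟩ := h
      have := ih _ (hn ▸ h) _ rfl
      refine conj φ g ?_
      cases p
      · exact elem_inv_mul _ i this
      · exact elem_mul _ i this

section

variable {G : Type*} [Group G]

theorem exists_mul_eq_of_conj {A B : Set G} {ρ : G}
    (h : ∀ x ∈ A, ∃ y ∈ Submonoid.closure B, x * ρ = ρ * y)
    {c : G} (hc : c ∈ Submonoid.closure A) : ∃ d ∈ Submonoid.closure B, c * ρ = ρ * d := by
  induction hc using Submonoid.closure_induction with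
  | mem x hx => exact h x hx
  | one => exact ⟨1, one_mem _, by simp⟩
  | mul x y _ _ hx hy =>
    obtain ⟨d, hd, hd'⟩ := hx
    obtain ⟨e, he, he'⟩ := hy
    exact ⟨d * e, mul_mem hd he, by rw [mul_assoc, he', ← mul_assoc, hd', mul_assoc]⟩

/-- For the submonoids generated by `A` and `B`, of which the second may be moved into the first by
conjugation with elements `ρ` of `I`, the set `I * (⟨A⟩ ∪ ⟨B⟩)` is closed under right
multiplication by an element of `A`. -/
theorem mul_generator_mem {I : Subgroup G} {A B : Set G} {x g : G} (hgA : g ∈ A)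
    (hB : ∀ y ∈ B, y = g⁻¹ ∨ ∃ ρ ∈ I, ∃ z ∈ A, y * g = ρ * z ∧
      ∀ x ∈ B, ∃ w ∈ Submonoid.closure A, x * ρ = ρ * w)
    (hx : ∃ π ∈ I, ∃ c, (c ∈ Submonoid.closure A ∨ c ∈ Submonoid.closure B) ∧ x = π * c) :
    ∃ π ∈ I, ∃ c, (c ∈ Submonoid.closure A ∨ c ∈ Submonoid.closure B) ∧ x * g = π * c := by
  obtain ⟨π, hπ, c, hc, rfl⟩ := hx
  have hg := Submonoid.subset_closure hgA
  rcases hc with hc | hc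
  · exact ⟨π, hπ, c * g, Or.inl (mul_mem hc hg), mul_assoc _ _ _⟩
  · have key : ∀ c ∈ Submonoid.closure B, c = 1 ∨
        ∃ d ∈ Submonoid.closure B, ∃ y ∈ B, c = d * y := by
      intro c hc
      induction hc using Submonoid.closure_induction_right with
      | one => exact Or.inl rfl
      | mul_right d hd y hy _ => exact Or.inr ⟨d, hd, y, hy, rfl⟩
    rcases key c hc with rfl | ⟨d, hd, y, hy, rfl⟩
    · exact ⟨π, hπ, g, Or.inl hg, by rw [mul_one]⟩
    · rcases hB y hy with rfl | ⟨ρ, hρ, z, hz, hyz, hBA⟩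
      · exact ⟨π, hπ, d, Or.inr hd, by group⟩
      · obtain ⟨w, hw, hdw⟩ := exists_mul_eq_of_conj hBA hd
        refine ⟨π * ρ, mul_mem hπ hρ, w * z, Or.inl (mul_mem hw (Submonoid.subset_closure hz)), ?_⟩
        rw [mul_assoc, mul_assoc d, hyz, ← mul_assoc d, hdw]
        group

/-- If `ρ = t s⁻¹ t` lies in `I` and conjugation by `ρ` maps `s` to `t⁻¹` and `t` to `s⁻¹`, then the
products of an element of `I` with a word in `s, t` or a word in `s⁻¹, t⁻¹` form a set that is
closed under right multiplication by `s`, `t` and their inverses. -/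
theorem mul_mem_chains {I : Subgroup G} {s t : G} (hρ : t * s⁻¹ * t ∈ I)
    (hst : s * (t * s⁻¹ * t) = (t * s⁻¹ * t) * t⁻¹) (hts : t * (t * s⁻¹ * t) = (t * s⁻¹ * t) * s⁻¹)
    {x g : G} (hg : g = s ∨ g = t ∨ g = s⁻¹ ∨ g = t⁻¹)
    (hx : ∃ π ∈ I, ∃ c, (c ∈ Submonoid.closure {s, t} ∨ c ∈ Submonoid.closure {s⁻¹, t⁻¹}) ∧
      x = π * c) :
    ∃ π ∈ I, ∃ c, (c ∈ Submonoid.closure {s, t} ∨ c ∈ Submonoid.closure {s⁻¹, t⁻¹}) ∧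
      x * g = π * c := by
  obtain ⟨ρ, hρdef⟩ : ∃ ρ, ρ = t * s⁻¹ * t := ⟨_, rfl⟩
  rw [← hρdef] at hρ hst hts
  have hρ' := inv_mem hρ
  have hti : ρ⁻¹ * s * ρ = t⁻¹ := by rw [mul_assoc, hst]; group
  have hsi : ρ⁻¹ * t * ρ = s⁻¹ := by rw [mul_assoc, hts]; group
  have e1 : s⁻¹ * ρ = ρ * t := by rw [← inv_inj, ← inv_inv t, ← hti]; group
  have e2 : t⁻¹ * ρ = ρ * s := by rw [← inv_inj, ← inv_inv s, ← hsi]; group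
  have f1 : s * ρ⁻¹ = ρ⁻¹ * t⁻¹ := by rw [← inv_inj]; simpa using hts.symm
  have f2 : t * ρ⁻¹ = ρ⁻¹ * s⁻¹ := by rw [← inv_inj]; simpa using hst.symm
  have f3 : s⁻¹ * ρ⁻¹ = ρ⁻¹ * t := by rw [← inv_inj]; simpa using e2.symm
  have f4 : t⁻¹ * ρ⁻¹ = ρ⁻¹ * s := by rw [← inv_inj]; simpa using e1.symm
  have mem (A : Set G) {y : G} (hy : y ∈ A) := Submonoid.subset_closure hy
  have p1 : ∀ x ∈ ({s, t} : Set G), ∃ w ∈ Submonoid.closure {s⁻¹, t⁻¹}, x * ρ = ρ * w := by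
    rintro x (rfl | rfl)
    · exact ⟨_, mem _ (by simp), hst⟩
    · exact ⟨_, mem _ (by simp), hts⟩
  have p2 : ∀ x ∈ ({s, t} : Set G), ∃ w ∈ Submonoid.closure {s⁻¹, t⁻¹}, x * ρ⁻¹ = ρ⁻¹ * w := by
    rintro x (rfl | rfl)
    · exact ⟨_, mem _ (by simp), f1⟩
    · exact ⟨_, mem _ (by simp), f2⟩
  have p3 : ∀ x ∈ ({s⁻¹, t⁻¹} : Set G), ∃ w ∈ Submonoid.closure {s, t}, x * ρ = ρ * w := by
    rintro x (rfl | rfl)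
    · exact ⟨_, mem _ (by simp), e1⟩
    · exact ⟨_, mem _ (by simp), e2⟩
  have p4 : ∀ x ∈ ({s⁻¹, t⁻¹} : Set G), ∃ w ∈ Submonoid.closure {s, t}, x * ρ⁻¹ = ρ⁻¹ * w := by
    rintro x (rfl | rfl)
    · exact ⟨_, mem _ (by simp), f3⟩
    · exact ⟨_, mem _ (by simp), f4⟩
  have swap {x : G} (h : ∃ π ∈ I, ∃ c, (c ∈ Submonoid.closure {s, t} ∨
      c ∈ Submonoid.closure {s⁻¹, t⁻¹}) ∧ x = π * c) : ∃ π ∈ I, ∃ c,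
      (c ∈ Submonoid.closure {s⁻¹, t⁻¹} ∨ c ∈ Submonoid.closure {s, t}) ∧ x = π * c := by
    obtain ⟨π, hπ, c, hc, h⟩ := h
    exact ⟨π, hπ, c, hc.symm, h⟩
  have swap' {x : G} (h : ∃ π ∈ I, ∃ c, (c ∈ Submonoid.closure {s⁻¹, t⁻¹} ∨
      c ∈ Submonoid.closure {s, t}) ∧ x = π * c) : ∃ π ∈ I, ∃ c,
      (c ∈ Submonoid.closure {s, t} ∨ c ∈ Submonoid.closure {s⁻¹, t⁻¹}) ∧ x = π * c := by
    obtain ⟨π, hπ, c, hc, h⟩ := h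
    exact ⟨π, hπ, c, hc.symm, h⟩
  rcases hg with rfl | rfl | rfl | rfl
  · refine mul_generator_mem (by simp) ?_ hx
    rintro y (rfl | rfl)
    · exact Or.inl rfl
    · exact Or.inr ⟨ρ⁻¹, hρ', t, by simp, by rw [hρdef]; group, p4⟩
  · refine mul_generator_mem (by simp) ?_ hx
    rintro y (rfl | rfl)
    · exact Or.inr ⟨ρ, hρ, s, by simp, by rw [← e2, hρdef]; group, p3⟩
    · exact Or.inl rfl
  · refine swap' (mul_generator_mem (by simp) ?_ (swap hx))
    rintro y (rfl | rfl)
    · exact Or.inl (by simp)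
    · exact Or.inr ⟨ρ, hρ, y⁻¹, by simp, by rw [hρdef]; group, p1⟩
  · refine swap' (mul_generator_mem (by simp) ?_ (swap hx))
    rintro y (rfl | rfl)
    · exact Or.inr ⟨ρ⁻¹, hρ', y⁻¹, by simp, by rw [← f2, hρdef]; group, p2⟩
    · exact Or.inl (by simp)

end

/-- The group of inner automorphisms. -/
def innerAut : Subgroup (MulAut F2) := (MulAut.conj : F2 →* MulAut F2).range

instance : innerAut.Normal where
  conj_mem := by
    rintro _ ⟨g, rfl⟩ φ
    refine ⟨φ g, ?_⟩
    ext w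
    simp [MulAut.mul_apply]

/-- The outer automorphism group. -/
abbrev Out : Type := MulAut F2 ⧸ innerAut

/-- The projection of an automorphism to its outer class. -/
abbrev toOut : MulAut F2 →* Out := QuotientGroup.mk' innerAut

theorem toOut_conj (g : F2) : toOut (MulAut.conj g) = 1 :=
  (QuotientGroup.eq_one_iff _).2 ⟨g, rfl⟩

theorem cycLen_eq_of_toOut_eq {φ ψ : MulAut F2} (h : toOut φ = toOut ψ) (w : F2) :
    cycLen (φ w) = cycLen (ψ w) := by
  obtain ⟨g, hg⟩ := QuotientGroup.eq.1 h
  rw [eq_inv_mul_iff_mul_eq] at hg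
  rw [← hg, MulAut.mul_apply, MulAut.conj_apply, map_mul, map_mul, map_inv, cycLen_conj]

theorem aut_ext {φ ψ : MulAut F2} (ha : φ a = ψ a) (hb : φ b = ψ b) : φ = ψ := by
  apply MulEquiv.toMonoidHom_injective
  ext i
  fin_cases i
  · exact ha
  · exact hb

theorem sigma_inv_a : sigma⁻¹ a = a * b⁻¹ := elem_inv_of_rev 1

theorem sigma_inv_b : sigma⁻¹ b = b := elem_inv_of_self 1

/-- The automorphism `τ σ⁻¹ τ`, conjugated so as to be the signed permutation
`a ↦ b⁻¹`, `b ↦ a`. -/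
def rot : MulAut F2 := MulAut.conj b⁻¹ * (tau * sigma⁻¹ * tau)

theorem rot_a : rot a = b⁻¹ := by
  rw [rot, MulAut.mul_apply, MulAut.conj_apply, MulAut.mul_apply, MulAut.mul_apply, tau_a,
    sigma_inv_a, map_mul, map_inv, tau_a, tau_b]
  group

theorem rot_b : rot b = a := by
  rw [rot, MulAut.mul_apply, MulAut.conj_apply, MulAut.mul_apply, MulAut.mul_apply, tau_b,
    map_mul, sigma_inv_a, sigma_inv_b, map_mul, map_mul, map_inv, tau_a, tau_b]
  group

/-- Every outer class is an isometry times a positive or a negative word in the classes of `σ`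
and `τ`. -/
theorem exists_toOut_eq (φ : MulAut F2) : ∃ π ∈ isometries.map toOut, ∃ c,
    (c ∈ Submonoid.closure {toOut sigma, toOut tau} ∨
      c ∈ Submonoid.closure {(toOut sigma)⁻¹, (toOut tau)⁻¹}) ∧ toOut φ = π * c := by
  have hrot : toOut tau * (toOut sigma)⁻¹ * toOut tau = toOut rot := by
    rw [rot, map_mul, toOut_conj, one_mul]; rfl
  have h0 : toOut tau * (toOut sigma)⁻¹ * toOut tau ∈ isometries.map toOut := by
    rw [hrot]
    refine Subgroup.mem_map_of_mem _ (mem_isometries_of_letters fun i => ?_)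
    fin_cases i
    · exact ⟨(1, false), rot_a⟩
    · exact ⟨(0, true), rot_b⟩
  have h1 : toOut sigma * (toOut tau * (toOut sigma)⁻¹ * toOut tau) =
      toOut tau * (toOut sigma)⁻¹ * toOut tau * (toOut tau)⁻¹ := by
    rw [hrot, eq_mul_inv_iff_mul_eq, ← map_mul, ← map_mul]
    congr 1
    apply aut_ext <;>
      simp [MulAut.mul_apply, tau_a, tau_b, rot_a, rot_b, sigma_a, sigma_b]
  have h2 : toOut tau * (toOut tau * (toOut sigma)⁻¹ * toOut tau) =
      toOut tau * (toOut sigma)⁻¹ * toOut tau * (toOut sigma)⁻¹ := by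
    rw [hrot, eq_mul_inv_iff_mul_eq, ← map_mul, ← map_mul]
    have : tau * rot * sigma = MulAut.conj a⁻¹ * rot := by
      apply aut_ext <;>
        simp [MulAut.mul_apply, tau_a, tau_b, rot_a, rot_b, sigma_a, sigma_b]
    rw [this, map_mul, toOut_conj, one_mul]
  have hmul {x g : Out} := mul_mem_chains (x := x) (g := g) h0 h1 h2
  induction φ using aut_induction with
  | isom φ hφ => exact ⟨_, Subgroup.mem_map_of_mem _ hφ, 1, Or.inl (one_mem _), by rw [mul_one]⟩
  | conj φ g ih => rwa [map_mul, toOut_conj, one_mul] at ih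
  | elem_mul φ i ih =>
    have := hmul (x := toOut (φ * elem i)) (g := (toOut (elem i))⁻¹)
      (by fin_cases i <;> simp [elem]) ih
    rwa [map_mul, mul_inv_cancel_right] at this
  | elem_inv_mul φ i ih =>
    have := hmul (x := toOut (φ * (elem i)⁻¹)) (g := toOut (elem i))
      (by fin_cases i <;> simp [elem]) ih
    rwa [map_mul, map_inv, inv_mul_cancel_right] at this

theorem exists_chainC1_of_mem_closure {c : Out}
    (hc : c ∈ Submonoid.closure {toOut sigma, toOut tau}) : ∃ L, c = toOut (chainC1 L) := by
  induction hc using Submonoid.closure_induction_left with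
  | one => exact ⟨[], (map_one _).symm⟩
  | mul_left x hx y _ ih =>
    obtain ⟨L, rfl⟩ := ih
    rcases hx with rfl | rfl
    · exact ⟨(0, 1) :: L, by simp [chainC1]⟩
    · exact ⟨(1, 0) :: L, by simp [chainC1]⟩

theorem exists_chainC2_of_mem_closure {c : Out}
    (hc : c ∈ Submonoid.closure {(toOut sigma)⁻¹, (toOut tau)⁻¹}) :
    ∃ L, c = toOut (chainC2 L) := by
  induction hc using Submonoid.closure_induction_left with
  | one => exact ⟨[], (map_one _).symm⟩
  | mul_left x hx y _ ih =>
    obtain ⟨L, rfl⟩ := ih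
    rcases hx with rfl | rfl
    · exact ⟨(0, 1) :: L, by simp [chainC2]⟩
    · exact ⟨(1, 0) :: L, by simp [chainC2]⟩

theorem exists_chain (φ : MulAut F2) : ∃ L, (∀ w, cycLen (φ w) = cycLen (chainC1 L w)) ∨
    ∀ w, cycLen (φ w) = cycLen (chainC2 L w) := by
  have key {ψ : MulAut F2} {π : Out} (hπ : π ∈ isometries.map toOut)
      (h : toOut φ = π * toOut ψ) (w : F2) : cycLen (φ w) = cycLen (ψ w) := by
    obtain ⟨π, hπ, rfl⟩ := hπ
    rw [← map_mul] at h
    rw [cycLen_eq_of_toOut_eq h, MulAut.mul_apply]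
    exact hπ _
  obtain ⟨π, hπ, c, hc | hc, h⟩ := exists_toOut_eq φ
  · obtain ⟨L, rfl⟩ := exists_chainC1_of_mem_closure hc
    exact ⟨L, Or.inl (key hπ h)⟩
  · obtain ⟨L, rfl⟩ := exists_chainC2_of_mem_closure hc
    exact ⟨L, Or.inr (key hπ h)⟩

/-! ### Chains and lists of steps -/

/-- The product of the automorphisms `elem i`, where the head of the list is applied first. -/
def autOf (l : List (Fin 2)) : MulAut F2 := (l.map elem).reverse.prod

theorem autOf_append (l l' : List (Fin 2)) : autOf (l ++ l') = autOf l' * autOf l := by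
  simp [autOf]

theorem autOf_cons (i : Fin 2) (l : List (Fin 2)) : autOf (i :: l) = autOf l * elem i := by
  simp [autOf]

theorem autOf_replicate (n : ℕ) (i : Fin 2) : autOf (List.replicate n i) = elem i ^ n := by
  simp [autOf]

theorem exists_chainC1_eq_autOf (l : List (Fin 2)) :
    ∃ L, chainLen L = l.length ∧ chainC1 L = autOf l := by
  induction l with
  | nil => exact ⟨[], rfl, rfl⟩
  | cons i l ih =>
    obtain ⟨L, h1, h2⟩ := ih
    refine ⟨L ++ [if i = 1 then (0, 1) else (1, 0)], ?_, ?_⟩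
    · simp only [chainLen, List.map_append, List.sum_append] at h1 ⊢
      rw [h1]
      fin_cases i <;> simp
    · simp only [chainC1, List.map_append, List.prod_append] at h2 ⊢
      rw [h2, autOf_cons]
      fin_cases i <;> simp [elem]

theorem exists_autOf_eq_chainC1 (L : List (ℕ × ℕ)) :
    ∃ l : List (Fin 2), l.length = chainLen L ∧ autOf l = chainC1 L := by
  induction L with
  | nil => exact ⟨[], rfl, rfl⟩
  | cons p L ih =>
    obtain ⟨l, h1, h2⟩ := ih
    refine ⟨l ++ (List.replicate p.2 1 ++ List.replicate p.1 0), ?_, ?_⟩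
    · simp only [chainLen, List.length_append, List.length_replicate, List.map_cons,
        List.sum_cons] at h1 ⊢
      omega
    · rw [autOf_append, autOf_append, autOf_replicate, autOf_replicate, h2]
      rfl

theorem omega1_eq (N : ℕ) : Omega1 N = autOf '' {l | l.length ≤ N} := by
  ext ψ
  constructor
  · rintro ⟨L, hL, rfl⟩
    obtain ⟨l, h1, h2⟩ := exists_autOf_eq_chainC1 L
    exact ⟨l, h1.trans_le hL, h2⟩
  · rintro ⟨l, hl, rfl⟩
    obtain ⟨L, h1, h2⟩ := exists_chainC1_eq_autOf l
    exact ⟨L, h1.trans_le hl, h2⟩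

theorem finite_omega1 (N : ℕ) : (Omega1 N).Finite := by
  rw [omega1_eq]
  exact (List.finite_length_le (Fin 2) N).image _

theorem CyclicRun.cycLen_eq {r : CyclicRun} {w : F2}
    (h : ∃ g, FreeGroup.mk r.word = g * w * g⁻¹) : (cycLen w : ℤ) = r.len := by
  obtain ⟨g, hg⟩ := h
  rw [← cycLen_conj g, ← hg, cycLen_mk_of_isCyclicallyReduced r.isCyclicallyReduced, r.length_word]
  rfl

theorem CyclicRun.cycLen_autOf {r : CyclicRun} {w : F2}
    (h : ∃ g, FreeGroup.mk r.word = g * w * g⁻¹) (l : List (Fin 2)) :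
    (cycLen (autOf l w) : ℤ) = (r.evolve l).len := by
  induction l generalizing r w with
  | nil => exact cycLen_eq h
  | cons i l ih =>
    rw [autOf_cons, MulAut.mul_apply, evolve_cons]
    apply ih
    obtain ⟨g, hg⟩ := h
    obtain ⟨g', hg'⟩ := (isStep_step i r).conj
    refine ⟨g' * elem i g, ?_⟩
    rw [hg', hg, map_mul, map_mul, map_inv]
    group

theorem inCone_of_div_mem {m M : ℝ} {x y : ℤ} (hy : 0 < y) (h : m ≤ (x : ℝ) / y ∧ (x : ℝ) / y ≤ M) :
    InCone m M x y := by
  have hy' : (0 : ℝ) < y := by exact_mod_cast hy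
  exact ⟨(le_div_iff₀ hy').1 h.1, (div_le_iff₀ hy').1 h.2⟩

theorem map_ne_one (φ : MulAut F2) {w : F2} (hw : w ≠ 1) : φ w ≠ 1 := by
  rwa [Ne, EmbeddingLike.map_eq_one_iff]

/-- The ratio bounds for all positive chains follow from those for short ones. The hypothesis on the
exponents `k + 1` and `k` says that two increments vanish simultaneously: when `elem i` acts
linearly, its increment is the same at every power. -/
theorem div_mem_autOf {u v : F2} (hv : v ≠ 1) (huv : cycLen v ≤ cycLen u) {k N : ℕ} {m M : ℝ}
    (hN : 2 * cycLen u + 1 ≤ N)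
    (h : ∀ l : List (Fin 2), l.length ≤ N → ∀ i,
      (cycLen ((elem i ^ (k + 1)) (autOf l u)) = cycLen ((elem i ^ k) (autOf l u)) ↔
        cycLen ((elem i ^ (k + 1)) (autOf l v)) = cycLen ((elem i ^ k) (autOf l v))))
    (hlen : ∀ l : List (Fin 2), l.length ≤ N →
      m ≤ (cycLen (autOf l u) : ℝ) / cycLen (autOf l v) ∧
        (cycLen (autOf l u) : ℝ) / cycLen (autOf l v) ≤ M)
    (hincr : ∀ l : List (Fin 2), l.length ≤ N → ∀ i,
      m ≤ (incr (elem i) (autOf l) u : ℝ) / incr (elem i) (autOf l) v ∧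
        (incr (elem i) (autOf l) u : ℝ) / incr (elem i) (autOf l) v ≤ M)
    (l : List (Fin 2)) :
    m ≤ (cycLen (autOf l u) : ℝ) / cycLen (autOf l v) ∧
      (cycLen (autOf l u) : ℝ) / cycLen (autOf l v) ≤ M := by
  have rep (w : F2) : ∃ r : CyclicRun, ∃ g, FreeGroup.mk r.word = g * w * g⁻¹ := by
    obtain ⟨r, g, hr⟩ := exists_cyclicRun w
    exact ⟨r, g⁻¹, by rw [hr]; group⟩
  obtain ⟨r, hr⟩ := rep u
  obtain ⟨s, hs⟩ := rep v
  have hrl := CyclicRun.cycLen_autOf hr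
  have hsl := CyclicRun.cycLen_autOf hs
  have hpos (l : List (Fin 2)) : 0 < cycLen (autOf l v) := cycLen_pos (map_ne_one _ hv)
  have hu : 0 < cycLen u := (cycLen_pos hv).trans_le huv
  obtain ⟨K, hK⟩ := Nat.exists_eq_add_one_of_ne_zero hu.ne'
  have hrf := r.flagged_le_len
  have hsf := s.flagged_le_len
  rw [← CyclicRun.cycLen_eq hr, hK] at hrf
  rw [← CyclicRun.cycLen_eq hs] at hsf
  have hpow (l : List (Fin 2)) (i : Fin 2) (n : ℕ) (w : F2) :
      (elem i ^ n) (autOf l w) = autOf (l ++ List.replicate n i) w := by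
    rw [autOf_append, autOf_replicate]; rfl
  have hcone := inCone_evolve (m := m) (M := M) (K := K) (N := N) (r := r) (s := s) (by omega) hrf
    (hsf.trans (by exact_mod_cast hK ▸ huv)) (fun l hl => by
      rw [← hrl, ← hsl]
      refine inCone_of_div_mem (by exact_mod_cast hpos l) ?_
      simpa only [Int.cast_natCast] using hlen l hl) (fun l hl i h1 h2 => by
      have hr0 := CyclicRun.inc_nonneg_of_opp h1
      have hs0 := CyclicRun.inc_nonneg_of_opp h2
      have eqv {r : CyclicRun} {w : F2} (hw : ∀ l, (cycLen (autOf l w) : ℤ) = (r.evolve l).len)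
          (h0 : (r.evolve l).count (opp i) = 0) :
          cycLen ((elem i ^ (k + 1)) (autOf l w)) = cycLen ((elem i ^ k) (autOf l w)) ↔
            (r.evolve l).inc i = 0 := by
        rw [← Nat.cast_inj (R := ℤ), hpow, hpow, hw, hw, CyclicRun.evolve_append,
          CyclicRun.evolve_append, (CyclicRun.evolve_replicate_of_opp h0 _).2,
          (CyclicRun.evolve_replicate_of_opp h0 _).2]
        push_cast
        constructor <;> intro h <;> linarith
      have hincr' {r : CyclicRun} {w : F2} (hw : ∀ l, (cycLen (autOf l w) : ℤ) = (r.evolve l).len) :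
          incr (elem i) (autOf l) w = max 1 ((r.evolve l).inc i) := by
        have := hpow l i 1 w
        rw [pow_one] at this
        rw [incr, this, hw, hw, CyclicRun.evolve_append]
        change max 1 (((r.evolve l).step i).len - _) = _
        rw [CyclicRun.len_step, add_sub_cancel_left]
      have hiff := h l hl i
      rw [eqv hrl h1, eqv hsl h2] at hiff
      rcases hs0.eq_or_lt with h0 | h0
      · rw [← h0, hiff.2 h0.symm]
        simp [InCone]
      · have h0' : 0 < (r.evolve l).inc i :=
          lt_of_le_of_ne hr0 fun h => h0.ne' (hiff.1 h.symm)
        have := hincr l hl i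
        rw [hincr' hrl, hincr' hsl, max_eq_right (by omega), max_eq_right (by omega)] at this
        exact inCone_of_div_mem h0 this) l
  rw [← hrl, ← hsl] at hcone
  have hy : (0 : ℝ) < cycLen (autOf l v) := by exact_mod_cast hpos l
  rw [le_div_iff₀ hy, div_le_iff₀ hy]
  exact_mod_cast hcone

/-! ### Chains of type (C2) and the set of ratios -/

/-- The automorphism `a ↦ a`, `b ↦ b⁻¹`, which turns chains of type (C2) into chains of type
(C1). -/
def flipB : MulAut F2 :=
  MonoidHom.toMulEquiv (FreeGroup.lift ![a, b⁻¹]) (FreeGroup.lift ![a, b⁻¹])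
    (by ext i; fin_cases i <;> simp [a, b]) (by ext i; fin_cases i <;> simp [a, b])

theorem flipB_a : flipB a = a := by simp [flipB, a]

theorem flipB_b : flipB b = b⁻¹ := by simp [flipB, b]

theorem flipB_mem_isometries : flipB ∈ isometries := by
  refine mem_isometries_of_letters fun i => ?_
  fin_cases i
  · exact ⟨(0, true), flipB_a⟩
  · exact ⟨(1, false), flipB_b⟩

theorem toOut_elem_mul_flipB (i : Fin 2) :
    toOut (elem i) * toOut flipB = toOut flipB * (toOut (elem i))⁻¹ := by
  rw [eq_mul_inv_iff_mul_eq, ← map_mul, ← map_mul]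
  fin_cases i
  · have : tau * flipB * tau = MulAut.conj a⁻¹ * flipB := by
      apply aut_ext <;> simp [MulAut.mul_apply, tau_a, tau_b, flipB_a, flipB_b]
    change toOut (tau * flipB * tau) = _
    rw [this, map_mul, toOut_conj, one_mul]
  · congr 1
    change sigma * flipB * sigma = flipB
    apply aut_ext <;> simp [MulAut.mul_apply, sigma_a, sigma_b, flipB_a, flipB_b]

theorem toOut_elem_pow_mul_flipB (i : Fin 2) (n : ℕ) :
    toOut (elem i ^ n) * toOut flipB = toOut flipB * toOut ((elem i)⁻¹ ^ n) := by
  rw [map_pow, map_pow, map_inv]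
  exact (SemiconjBy.pow_right (show SemiconjBy (toOut flipB) (toOut (elem i))⁻¹ (toOut (elem i))
    from (toOut_elem_mul_flipB i).symm) n).symm

theorem toOut_chainC1_mul_flipB (L : List (ℕ × ℕ)) :
    toOut (chainC1 L) * toOut flipB = toOut flipB * toOut (chainC2 L) := by
  induction L with
  | nil => simp [chainC1, chainC2]
  | cons p L ih =>
    have h1 : chainC1 (p :: L) = elem 0 ^ p.1 * elem 1 ^ p.2 * chainC1 L := rfl
    have h2 : chainC2 (p :: L) = (elem 0)⁻¹ ^ p.1 * (elem 1)⁻¹ ^ p.2 * chainC2 L := rfl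
    rw [h1, h2, map_mul, map_mul, map_mul, map_mul, mul_assoc, ih, ← mul_assoc,
      mul_assoc (toOut (elem 0 ^ p.1)), toOut_elem_pow_mul_flipB, ← mul_assoc,
      toOut_elem_pow_mul_flipB]
    simp only [mul_assoc]

theorem cycLen_chainC1_flipB (i : Fin 2) (n : ℕ) (L : List (ℕ × ℕ)) (w : F2) :
    cycLen ((elem i ^ n) (chainC1 L (flipB w))) = cycLen (((elem i)⁻¹ ^ n) (chainC2 L w)) := by
  have h : toOut (elem i ^ n * chainC1 L * flipB) =
      toOut (flipB * ((elem i)⁻¹ ^ n * chainC2 L)) := by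
    rw [map_mul, map_mul, map_mul, map_mul, mul_assoc, toOut_chainC1_mul_flipB, ← mul_assoc,
      toOut_elem_pow_mul_flipB, mul_assoc]
  have := cycLen_eq_of_toOut_eq h w
  simp only [MulAut.mul_apply] at this
  rw [this]
  exact flipB_mem_isometries _

theorem finite_omega2 (N : ℕ) : (Omega2 N).Finite := by
  let S : Set (List (Fin 2)) := {l | l.length ≤ N}
  have hS : S.Finite := List.finite_length_le (Fin 2) N
  refine (hS.image fun l => ((l.map fun i => (elem i)⁻¹).reverse.prod : MulAut F2)).subset ?_
  rintro _ ⟨L, hL, rfl⟩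
  suffices ∃ l : List (Fin 2), l.length = chainLen L ∧
      ((l.map fun i => (elem i)⁻¹).reverse.prod : MulAut F2) = chainC2 L by
    obtain ⟨l, h1, h2⟩ := this
    exact ⟨l, h1.trans_le hL, h2⟩
  clear hL
  induction L with
  | nil => exact ⟨[], rfl, rfl⟩
  | cons p L ih =>
    obtain ⟨l, h1, h2⟩ := ih
    refine ⟨l ++ (List.replicate p.2 1 ++ List.replicate p.1 0), ?_, ?_⟩
    · simp only [chainLen, List.length_append, List.length_replicate, List.map_cons,
        List.sum_cons] at h1 ⊢
      omega
    · simp only [List.map_append, List.reverse_append, List.prod_append, h2, List.map_replicate,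
        List.reverse_replicate, List.prod_replicate]
      rfl

theorem incr_pos (β ψ : MulAut F2) (w : F2) : 0 < incr β ψ w := lt_max_of_lt_left one_pos

theorem finite_delta (N : ℕ) (u v : F2) : (Delta N u v).Finite := by
  refine ((Set.Finite.union ?_ ?_).union ?_)
  · refine (((finite_omega1 N).union (finite_omega2 N)).image
      fun ψ => (cycLen (ψ u) : ℝ) / (cycLen (ψ v) : ℝ)).subset ?_
    rintro _ ⟨ψ, hψ, rfl⟩
    exact ⟨ψ, hψ, rfl⟩
  · refine (((finite_omega1 N).prod (Set.toFinite {sigma, tau})).image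
      fun p => (incr p.2 p.1 u : ℝ) / (incr p.2 p.1 v : ℝ)).subset ?_
    rintro _ ⟨ψ, hψ, α, hα, rfl⟩
    exact ⟨(ψ, α), ⟨hψ, hα⟩, rfl⟩
  · refine (((finite_omega2 N).prod (Set.toFinite {sigma, tau})).image
      fun p => (incr p.2⁻¹ p.1 u : ℝ) / (incr p.2⁻¹ p.1 v : ℝ)).subset ?_
    rintro _ ⟨ψ, hψ, α, hα, rfl⟩
    exact ⟨(ψ, α), ⟨hψ, hα⟩, rfl⟩

theorem delta_pos {N : ℕ} {u v : F2} (hu : u ≠ 1) (hv : v ≠ 1) {x : ℝ} (hx : x ∈ Delta N u v) :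
    0 < x := by
  have hc {w : F2} (hw : w ≠ 1) (ψ : MulAut F2) : (0 : ℝ) < cycLen (ψ w) := by
    exact_mod_cast cycLen_pos (map_ne_one ψ hw)
  have hi (β ψ : MulAut F2) (w : F2) : (0 : ℝ) < incr β ψ w := by exact_mod_cast incr_pos β ψ w
  rcases hx with (⟨ψ, _, rfl⟩ | ⟨ψ, _, α, _, rfl⟩) | ⟨ψ, _, α, _, rfl⟩
  · exact div_pos (hc hu ψ) (hc hv ψ)
  · exact div_pos (hi _ _ _) (hi _ _ _)
  · exact div_pos (hi _ _ _) (hi _ _ _)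

theorem elem_eq (i : Fin 2) : elem i = sigma ∨ elem i = tau := by
  fin_cases i
  · exact Or.inr rfl
  · exact Or.inl rfl

end F2

theorem mainTheorem2 (u v : F2) (hv : v ≠ 1) (huv : F2.cycLen v ≤ F2.cycLen u)
    (k : ℕ) (hk : k = F2.cycLen u + 1)
    (N : ℕ) (hN : N = 2 * F2.cycLen u + 5)
    (h1 : ∀ ψ ∈ F2.Omega1 N, ∀ α : MulAut F2, α = F2.sigma ∨ α = F2.tau →
      (F2.cycLen ((α ^ (k + 1)) (ψ u)) = F2.cycLen ((α ^ k) (ψ u)) ↔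
        F2.cycLen ((α ^ (k + 1)) (ψ v)) = F2.cycLen ((α ^ k) (ψ v))))
    (h2 : ∀ ψ ∈ F2.Omega2 N, ∀ α : MulAut F2, α = F2.sigma ∨ α = F2.tau →
      (F2.cycLen ((α⁻¹ ^ (k + 1)) (ψ u)) = F2.cycLen ((α⁻¹ ^ k) (ψ u)) ↔
        F2.cycLen ((α⁻¹ ^ (k + 1)) (ψ v)) = F2.cycLen ((α⁻¹ ^ k) (ψ v)))) :
    F2.BoundedlyTranslationEquivalent u v ∧
      (F2.Delta N u v).Finite ∧ (∀ x ∈ F2.Delta N u v, 0 < x) ∧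
      ∃ m M : ℝ, IsLeast (F2.Delta N u v) m ∧ IsGreatest (F2.Delta N u v) M ∧
        ∀ φ : MulAut F2,
          m ≤ (F2.cycLen (φ u) : ℝ) / (F2.cycLen (φ v) : ℝ) ∧
            (F2.cycLen (φ u) : ℝ) / (F2.cycLen (φ v) : ℝ) ≤ M := by
  have hu : u ≠ 1 := by
    rintro rfl
    have := (F2.cycLen_pos hv).trans_le huv
    simp [F2.cycLen] at this
  have hfin := F2.finite_delta N u v
  have hpos : ∀ x ∈ F2.Delta N u v, 0 < x := fun x => F2.delta_pos hu hv
  have hone : (1 : MulAut F2) ∈ F2.Omega1 N := ⟨[], Nat.zero_le _, rfl⟩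
  have hne : (F2.Delta N u v).Nonempty := ⟨_, Or.inl (Or.inl ⟨1, Or.inl hone, rfl⟩)⟩
  obtain ⟨m, hm, hmin⟩ := Set.exists_min_image _ id hfin hne
  obtain ⟨M, hM, hmax⟩ := Set.exists_max_image _ id hfin hne
  have hΔ {x : ℝ} (hx : x ∈ F2.Delta N u v) : m ≤ x ∧ x ≤ M := ⟨hmin x hx, hmax x hx⟩
  have hmain (φ : MulAut F2) : m ≤ (F2.cycLen (φ u) : ℝ) / (F2.cycLen (φ v) : ℝ) ∧
      (F2.cycLen (φ u) : ℝ) / (F2.cycLen (φ v) : ℝ) ≤ M := by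
    obtain ⟨L, hL | hL⟩ := F2.exists_chain φ
    · rw [hL, hL]
      obtain ⟨l, -, hl⟩ := F2.exists_autOf_eq_chainC1 L
      have mem (l : List (Fin 2)) (hl : l.length ≤ N) : F2.autOf l ∈ F2.Omega1 N := by
        rw [F2.omega1_eq]; exact ⟨l, hl, rfl⟩
      rw [← hl]
      exact F2.div_mem_autOf hv huv (by omega)
        (fun l hl i => h1 _ (mem l hl) _ (F2.elem_eq i))
        (fun l hl => hΔ (Or.inl (Or.inl ⟨_, Or.inl (mem l hl), rfl⟩)))
        (fun l hl i => hΔ (Or.inl (Or.inr ⟨_, mem l hl, _, F2.elem_eq i, rfl⟩))) l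
    · have tr (i : Fin 2) (n : ℕ) (L : List (ℕ × ℕ)) (w : F2) := F2.cycLen_chainC1_flipB i n L w
      have tr0 (L : List (ℕ × ℕ)) (w : F2) :
          F2.cycLen (F2.chainC1 L (F2.flipB w)) = F2.cycLen (F2.chainC2 L w) := by
        simpa using tr 0 0 L w
      have tr1 (i : Fin 2) (L : List (ℕ × ℕ)) (w : F2) :
          F2.incr (F2.elem i) (F2.chainC1 L) (F2.flipB w) =
            F2.incr (F2.elem i)⁻¹ (F2.chainC2 L) w := by
        have := tr i 1 L w
        rw [pow_one, pow_one] at this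
        rw [F2.incr, F2.incr, this, tr0]
      rw [hL, hL, ← tr0, ← tr0]
      obtain ⟨l, -, hl⟩ := F2.exists_autOf_eq_chainC1 L
      rw [← hl]
      have hiso := F2.flipB_mem_isometries
      refine F2.div_mem_autOf (k := k) (N := N) (F2.map_ne_one _ hv) (by rw [hiso, hiso]; exact huv)
        (by rw [hiso]; omega) (fun l hl i => ?_) (fun l hl => ?_) (fun l hl i => ?_) l <;>
        obtain ⟨L, hL1, hL2⟩ := F2.exists_chainC1_eq_autOf l <;> rw [← hL2]
      · rw [tr, tr, tr, tr]
        exact h2 _ ⟨L, hL1.trans_le hl, rfl⟩ _ (F2.elem_eq i)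
      · rw [tr0, tr0]
        exact hΔ (Or.inl (Or.inl ⟨_, Or.inr ⟨L, hL1.trans_le hl, rfl⟩, rfl⟩))
      · rw [tr1, tr1]
        exact hΔ (Or.inr ⟨_, ⟨L, hL1.trans_le hl, rfl⟩, _, F2.elem_eq i, rfl⟩)
  refine ⟨⟨M + 1 / m, ?_, fun φ => ⟨?_, ?_⟩⟩, hfin, hpos, m, M, ⟨hm, fun x hx => (hΔ hx).1⟩,
    ⟨hM, fun x hx => (hΔ hx).2⟩, hmain⟩
  · have := hpos m hm
    have := hpos M hM
    positivity
  · have hm0 := hpos m hm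
    have hM0 := hpos M hM
    refine le_trans ?_ (hmain φ).1
    rw [div_le_iff₀ (by positivity), mul_add, mul_one_div_cancel hm0.ne']
    nlinarith
  · have hm0 := hpos m hm
    exact (hmain φ).2.trans (by have : 0 < 1 / m := by positivity
                                linarith)
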